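/- Let $G$ be a semisimple simply connected compact Lie group with complexified Lie algebra $\mathfrak g$ (a complex semisimple Lie algebra, which determines $G$ up to isomorphism). Let $\mathfrak h\subset\mathfrak g$ be a Cartan subalgebra, the complexified Lie algebra of a maximal torus $T\subset G$, let $Q\subset P\subset\mathfrak h^*$ be the root lattice and the weight lattice, and let $\alpha_1,\dots,\alpha_r$ be the simple roots for a fixed choice of positive roots. As usual, $T$ is identified with the group $\operatorname{Hom}(P,\mathbb T)$ of characters of $P$, and the center $Z(G)\subset T$ with the subgroup of characters that are trivial on $Q$, i.e. with the dual of $P/Q$; write $\langle t,\mu\rangle\in\mathbb T$ for the value of $t\in T$ at $\mu\in P$. For an abelian group $\Gamma$ and $f\colon\Gamma^2\to\mathbb T$ put $$(\partial f)(a,b,c)=f(b,c)\,f(a+b,c)^{-1}f(a,b+c)\,f(a,b)^{-1}.$$ A $\mathbb T$-valued $3$-cocycle on $\Gamma$ is a map $\Phi\colon\Gamma^3\to\mathbb T$ with $$\Phi(b,c,d)\,\Phi(a+b,c,d)^{-1}\,\Phi(a,b+c,d)\,\Phi(a,b,c+d)^{-1}\,\Phi(a,b,c)=1$$ for all $a,b,c,d\in\Gamma$;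 two $3$-cocycles on $\Gamma$ are cohomologous if their quotient is $\partial g$ for some $g\colon\Gamma^2\to\mathbb T$. A $3$-cocycle $\Phi$ on $P/Q$ lifts to a coboundary on $P$ if its pullback to $P^3$ equals $\partial g$ for some $g\colon P^2\to\mathbb T$. For $\tau=(\tau_1,\dots,\tau_r)\in Z(G)^r$ choose a function $f\colon P\times P\to\mathbb T$ such that $f(\lambda,\mu+\beta)=f(\lambda,\mu)$ for $\beta\in Q$ and $f(\lambda+\alpha_i,\mu)=\langle\tau_i,\mu\rangle f(\lambda,\mu)$ for $1\le i\le r$. Such an $f$ exists, $\partial f$ is $Q$-invariant in each variable, and $\Phi^\tau:=(\partial f)^{-1}$ is a $3$-cocycle on $P/Q$ whose cohomology class depends only on $\tau$. **Proposition.** A $\mathbb T$-valued $3$-cocycle $\Phi$ on $P/Q$ is cohomologous to $\Phi^\tau$ for some $\tau_1,\dots,\tau_r\in Z(G)$ if and only if $\Phi$ lifts to a coboundary on $P$. If $P/Q$ can be generated by at most two elements, then both conditions hold for every $\mathbb T$-valued $3$-cocycle $\Phi$ on $P/Q$. If $G$ is simple (i.e. $\mathfrak g$ is a simple Lie algebra),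 then $P/Q$ can be generated by at most two elements, so both conditions hold for every $\Phi$. -/

import Mathlib

noncomputable section

/-! ## Circle-valued cochains on an abelian group (nonnormalized standard complex) -/

namespace CircleCochain

variable {A : Type*} [AddCommGroup A]

/-- The coboundary of a `𝕋`-valued `2`-cochain `f` on `A` (trivial action):
`(∂f)(a, b, c) = f(b, c) f(a + b, c)⁻¹ f(a, b + c) f(a, b)⁻¹`. -/
def coboundary (f : A → A → Circle) : A → A → A → Circle :=
  fun a b c => f b c * (f (a + b) c)⁻¹ * f a (b + c) * (f a b)⁻¹

/-- `Φ` is a `𝕋`-valued `3`-cocycle on `A` (trivial action). -/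
def IsCocycle (Φ : A → A → A → Circle) : Prop :=
  ∀ a b c d : A,
    Φ b c d * (Φ (a + b) c d)⁻¹ * Φ a (b + c) d * (Φ a b (c + d))⁻¹ * Φ a b c = 1

/-- `Φ` and `Ψ` differ by the coboundary of a `2`-cochain on `A`. -/
def Cohomologous (Φ Ψ : A → A → A → Circle) : Prop :=
  ∃ g : A → A → Circle, ∀ a b c : A, Φ a b c = Ψ a b c * coboundary g a b c

/-- A `3`-cochain `Φ` on `A ⧸ N` lifts to a coboundary on `A`: its pullback along the quotient
map `A → A ⧸ N` is `∂g` for some `g : A × A → 𝕋`. -/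
def LiftsToCoboundary {N : AddSubgroup A} (Φ : A ⧸ N → A ⧸ N → A ⧸ N → Circle) : Prop :=
  ∃ g : A → A → Circle, ∀ a b c : A,
    Φ (a : A ⧸ N) (b : A ⧸ N) (c : A ⧸ N) = coboundary g a b c

theorem isCocycle_coboundary (f : A → A → Circle) : IsCocycle (coboundary f) := by
  intro a b c d
  simp only [coboundary, add_assoc]
  apply Circle.ext
  push_cast
  field_simp [Circle.coe_ne_zero]

end CircleCochain

/-! ## Weight lattice, root lattice, maximal torus and centre attached to a root system -/

namespace RootDatum

open CircleCochain

variable {ι k M N : Type*} [Field k] [CharZero k] [AddCommGroup M] [Module k M]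
  [AddCommGroup N] [Module k N]

section

variable (R : RootPairing ι k M N)

/-- The weight lattice `P`: the vectors pairing integrally with every coroot. -/
def weightLattice : AddSubgroup M where
  carrier := {x | ∀ i : ι, ∃ n : ℤ, R.toLinearMap x (R.coroot i) = (n : k)}
  zero_mem' := fun _ => ⟨0, by simp⟩
  add_mem' := by
    intro x y hx hy i
    obtain ⟨m, hm⟩ := hx i
    obtain ⟨n, hn⟩ := hy i
    exact ⟨m + n, by simp [hm, hn]⟩
  neg_mem' := by
    intro x hx i
    obtain ⟨m, hm⟩ := hx i
    exact ⟨-m, by simp [hm]⟩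

variable [R.IsCrystallographic]

/-- The roots, as elements of the weight lattice. -/
def rootWeight (i : ι) : weightLattice R :=
  ⟨R.root i, fun j => by
    obtain ⟨z, hz⟩ := RootPairing.IsValuedIn.exists_value (P := R) (S := ℤ) i j
    exact ⟨z, by rw [R.root_coroot_eq_pairing, ← hz]; simp⟩⟩

/-- The root lattice `Q`, as a subgroup of the weight lattice `P`. -/
def rootLattice : AddSubgroup (weightLattice R) :=
  AddSubgroup.closure (Set.range (rootWeight R))

/-- The finite abelian group `P / Q`. -/
abbrev WeightModRoot : Type _ := weightLattice R ⧸ rootLattice R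

/-- The maximal torus `T` with character group `P`, i.e. the group of characters `P → 𝕋`. -/
abbrev Torus : Type _ := AddChar (weightLattice R) Circle

/-- The centre `Z(G) = Q^⊥ ⊆ T` of the simply connected compact group with maximal torus `T`: the
elements of `T` which are trivial on all roots, i.e. the characters of `P` which are trivial
on `Q`. The pairing of `t : center R` with `μ : P` is `t.1 μ`. -/
def center : Subgroup (Torus R) where
  carrier := {t | ∀ i : ι, t (rootWeight R i) = 1}
  one_mem' := fun _ => by simp
  mul_mem' := by
    intro s t hs ht i
    rw [AddChar.mul_apply, hs i, ht i, one_mul]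
  inv_mem' := by
    intro s hs i
    rw [AddChar.inv_apply', hs i, inv_one]

end

variable {R : RootPairing ι k M N} [R.IsCrystallographic] {b : R.Base}

/-- The functions `f : P × P → 𝕋` attached to a tuple `τ` of elements of `Z(G)` indexed by the
simple roots: `f` is `Q`-invariant in the second variable, and
`f(α_i + x, y) = ⟨τ_i, y⟩ f(x, y)` for every simple root `α_i`. -/
structure TwistFunction (τ : b.support → center R) where
  /-- The underlying function. -/
  toFun : weightLattice R → weightLattice R → Circle
  add_root_right : ∀ x y q : weightLattice R, q ∈ rootLattice R → toFun x (y + q) = toFun x y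
  add_simple_left : ∀ (x y : weightLattice R) (i : b.support),
    toFun (x + rootWeight R i) y = (τ i).1 y * toFun x y

/-- The `3`-cocycle `Φ^τ = (∂f)^*` on `P / Q`, where `f` is a function attached to `τ`. It is
written through representatives; `phiTau_mk` says that it does not depend on them, because `∂f` is
`Q`-invariant in each variable. -/
def phiTau {τ : b.support → center R} (f : TwistFunction τ) :
    WeightModRoot R → WeightModRoot R → WeightModRoot R → Circle :=
  fun x y z => (coboundary f.toFun (Quotient.out x) (Quotient.out y) (Quotient.out z))⁻¹

/-! ### The construction makes sense -/

theorem mem_center_apply {t : Torus R} (ht : t ∈ center R) {q : weightLattice R}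
    (hq : q ∈ rootLattice R) : t q = 1 := by
  induction hq using AddSubgroup.closure_induction with
  | mem x hx => obtain ⟨i, rfl⟩ := hx; exact ht i
  | zero => simp
  | add x y _ _ hx hy => rw [AddChar.map_add_eq_mul, hx, hy, one_mul]
  | neg x _ hx => rw [AddChar.map_neg_eq_inv, hx, inv_one]

variable (b) in
/-- The root lattice is generated by the simple roots. -/
theorem rootLattice_eq_closure :
    rootLattice R = AddSubgroup.closure (Set.range fun i : b.support => rootWeight R i) := by
  apply le_antisymm
  · refine (AddSubgroup.closure_le _).2 ?_
    rintro _ ⟨i, rfl⟩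
    have key : ∀ x ∈ AddSubmonoid.closure (R.root '' b.support),
        ∃ h : x ∈ weightLattice R, (⟨x, h⟩ : weightLattice R) ∈
          AddSubgroup.closure (Set.range fun i : b.support => rootWeight R i) := by
      intro x hx
      induction hx using AddSubmonoid.closure_induction with
      | mem x hx =>
        obtain ⟨j, hj, rfl⟩ := hx
        exact ⟨(rootWeight R j).2, AddSubgroup.subset_closure ⟨⟨j, hj⟩, rfl⟩⟩
      | zero => exact ⟨zero_mem _, zero_mem _⟩
      | add x y _ _ hx hy =>
        obtain ⟨h1, h2⟩ := hx
        obtain ⟨h3, h4⟩ := hy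
        exact ⟨add_mem h1 h3, add_mem h2 h4⟩
    rcases b.root_mem_or_neg_mem i with h | h
    · exact (key _ h).2
    · obtain ⟨h1, h2⟩ := key _ h
      have := neg_mem h2
      have e : -(⟨-R.root i, h1⟩ : weightLattice R) = rootWeight R i :=
        Subtype.ext (neg_neg _)
      rwa [e] at this
  · refine AddSubgroup.closure_mono ?_
    rintro _ ⟨i, rfl⟩
    exact ⟨i, rfl⟩

namespace TwistFunction

variable {τ : b.support → center R}

/-- For every tuple `τ` there is a function `f` as above. -/
theorem nonempty (τ : b.support → center R) : Nonempty (TwistFunction τ) := by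
  classical
  have hli : LinearIndependent ℤ (fun i : b.support => rootWeight R i) := by
    have h1 : LinearIndependent ℤ (fun i : b.support => R.root i) :=
      LinearIndependent.restrict_scalars' (R := ℤ) b.linearIndepOn_root
    exact LinearIndependent.of_comp (weightLattice R).subtype.toIntLinearMap h1
  let B := Module.Basis.span hli
  have hspan : ∀ q ∈ rootLattice R,
      q ∈ Submodule.span ℤ (Set.range fun i : b.support => rootWeight R i) := by
    intro q hq
    rw [rootLattice_eq_closure b] at hq
    rw [← Submodule.mem_toAddSubgroup, Submodule.span_int_eq_addSubgroupClosure]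
    exact hq
  have hout : ∀ x : weightLattice R,
      x - Quotient.out (x : WeightModRoot R) ∈
        Submodule.span ℤ (Set.range fun i : b.support => rootWeight R i) := by
    intro x
    apply hspan
    rw [← QuotientAddGroup.eq_iff_sub_mem]
    exact (QuotientAddGroup.out_eq' _).symm
  let c : weightLattice R → b.support →₀ ℤ := fun x => B.repr ⟨_, hout x⟩
  refine ⟨⟨fun x y => ∏ i, ((τ i).1 y) ^ (c x i), ?_, ?_⟩⟩
  · intro x y q hq
    simp only [AddChar.map_add_eq_mul, mem_center_apply (τ _).2 hq, mul_one]
  · intro x y i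
    have hc : c (x + rootWeight R i) = c x + Finsupp.single i 1 := by
      have hq : ((x + rootWeight R i : weightLattice R) : WeightModRoot R) = x := by
        rw [QuotientAddGroup.eq_iff_sub_mem, add_sub_cancel_left]
        exact AddSubgroup.subset_closure ⟨i, rfl⟩
      have hB : B.repr (B i) = Finsupp.single i 1 := B.repr_self i
      rw [← hB]
      simp only [c]
      rw [← map_add]
      congr 1
      apply Subtype.ext
      have hBi : ((B i : _) : weightLattice R) = rootWeight R i := by
        simp [B, Module.Basis.span_apply]
      rw [Submodule.coe_add, hBi]
      simp only [hq]
      abel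
    simp only [hc, Finsupp.add_apply, zpow_add, Finset.prod_mul_distrib]
    rw [mul_comm]
    congr 1
    rw [Finset.prod_eq_single i]
    · simp
    · intro j _ hj
      simp [hj.symm]
    · simp

theorem exists_char (f : TwistFunction τ) {q : weightLattice R} (hq : q ∈ rootLattice R) :
    ∃ t : Torus R, ∀ x y, f.toFun (x + q) y = t y * f.toFun x y := by
  rw [rootLattice_eq_closure b] at hq
  induction hq using AddSubgroup.closure_induction with
  | mem x hx =>
    obtain ⟨i, rfl⟩ := hx
    exact ⟨(τ i).1, fun x y => f.add_simple_left x y i⟩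
  | zero => exact ⟨1, by simp⟩
  | add p q _ _ hp hq =>
    obtain ⟨s, hs⟩ := hp
    obtain ⟨t, ht⟩ := hq
    exact ⟨t * s, fun x y => by rw [← add_assoc, ht, hs, AddChar.mul_apply, mul_assoc]⟩
  | neg q _ hq =>
    obtain ⟨t, ht⟩ := hq
    refine ⟨t⁻¹, fun x y => ?_⟩
    have := ht (x + -q) y
    rw [neg_add_cancel_right] at this
    rw [this, AddChar.inv_apply', inv_mul_cancel_left]

theorem coboundary_add (f : TwistFunction τ) (x y z : weightLattice R) {p q r : weightLattice R}
    (hp : p ∈ rootLattice R) (hq : q ∈ rootLattice R) (hr : r ∈ rootLattice R) :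
    coboundary f.toFun (x + p) (y + q) (z + r) = coboundary f.toFun x y z := by
  obtain ⟨s, hs⟩ := f.exists_char hp
  obtain ⟨t, ht⟩ := f.exists_char hq
  have e1 : x + p + (y + q) = x + y + p + q := by abel
  have e2 : y + q + (z + r) = y + z + (q + r) := by abel
  simp only [coboundary, e1, e2, f.add_root_right _ _ _ (add_mem hq hr),
    f.add_root_right _ _ _ hq, f.add_root_right _ _ _ hr, hs, ht, AddChar.map_add_eq_mul]
  apply Circle.ext
  push_cast
  field_simp [Circle.coe_ne_zero]

end TwistFunction

theorem phiTau_mk {τ : b.support → center R} (f : TwistFunction τ) (x y z : weightLattice R) :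
    phiTau f (x : WeightModRoot R) (y : WeightModRoot R) (z : WeightModRoot R) =
      (coboundary f.toFun x y z)⁻¹ := by
  have h : ∀ x : weightLattice R,
      ∃ p ∈ rootLattice R, Quotient.out (x : WeightModRoot R) = x + p := by
    intro x
    refine ⟨-x + Quotient.out (x : WeightModRoot R), ?_, by abel⟩
    exact QuotientAddGroup.eq.1 (QuotientAddGroup.out_eq' (x : WeightModRoot R)).symm
  obtain ⟨p, hp, ep⟩ := h x
  obtain ⟨q, hq, eq⟩ := h y
  obtain ⟨r, hr, er⟩ := h z
  simp only [phiTau]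
  rw [ep, eq, er, f.coboundary_add _ _ _ hp hq hr]

/-- `Φ^τ` is a `3`-cocycle on `P / Q`. -/
theorem isCocycle_phiTau {τ : b.support → center R} (f : TwistFunction τ) :
    IsCocycle (phiTau f) := by
  intro x y z w
  induction x using QuotientAddGroup.induction_on with | _ x
  induction y using QuotientAddGroup.induction_on with | _ y
  induction z using QuotientAddGroup.induction_on with | _ z
  induction w using QuotientAddGroup.induction_on with | _ w
  have := congrArg (·⁻¹) (isCocycle_coboundary f.toFun x y z w)
  simp only [← QuotientAddGroup.mk_add, phiTau_mk]
  simpa [mul_inv, mul_comm, mul_left_comm, mul_assoc] using this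

/-- The cohomology class of `Φ^τ` depends only on `τ`. -/
theorem cohomologous_phiTau {τ : b.support → center R} (f f' : TwistFunction τ) :
    Cohomologous (phiTau f) (phiTau f') := by
  have inv : ∀ x y p q : weightLattice R, p ∈ rootLattice R → q ∈ rootLattice R →
      f'.toFun (x + p) (y + q) * (f.toFun (x + p) (y + q))⁻¹ =
        f'.toFun x y * (f.toFun x y)⁻¹ := by
    intro x y p q hp hq
    rw [f.add_root_right _ _ _ hq, f'.add_root_right _ _ _ hq]
    rw [rootLattice_eq_closure b] at hp
    clear hq
    induction hp using AddSubgroup.closure_induction generalizing x with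
    | mem p hp =>
      obtain ⟨i, rfl⟩ := hp
      simp only [f.add_simple_left, f'.add_simple_left]
      rw [mul_inv, mul_mul_mul_comm, mul_inv_cancel, one_mul]
    | zero => simp
    | add p q _ _ hp hq => rw [← add_assoc, hq, hp]
    | neg p _ hp =>
      have := hp (x + -p)
      rw [neg_add_cancel_right] at this
      exact this.symm
  have h : ∀ x : weightLattice R,
      ∃ p ∈ rootLattice R, Quotient.out (x : WeightModRoot R) = x + p := by
    intro x
    refine ⟨-x + Quotient.out (x : WeightModRoot R), ?_, by abel⟩
    exact QuotientAddGroup.eq.1 (QuotientAddGroup.out_eq' (x : WeightModRoot R)).symm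
  let g : WeightModRoot R → WeightModRoot R → Circle := fun x y =>
    f'.toFun (Quotient.out x) (Quotient.out y) * (f.toFun (Quotient.out x) (Quotient.out y))⁻¹
  have hg : ∀ x y : weightLattice R, g (x : WeightModRoot R) (y : WeightModRoot R) =
      f'.toFun x y * (f.toFun x y)⁻¹ := by
    intro x y
    obtain ⟨p, hp, ep⟩ := h x
    obtain ⟨q, hq, eq⟩ := h y
    simp only [g]
    rw [ep, eq, inv _ _ _ _ hp hq]
  refine ⟨g, fun x y z => ?_⟩
  induction x using QuotientAddGroup.induction_on with | _ x
  induction y using QuotientAddGroup.induction_on with | _ y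
  induction z using QuotientAddGroup.induction_on with | _ z
  simp only [phiTau_mk]
  simp only [coboundary, ← QuotientAddGroup.mk_add, hg]
  apply Circle.ext
  push_cast
  field_simp [Circle.coe_ne_zero]

end RootDatum

end

/-! The cocycle `Φ^τ` pulls back to the coboundary of `f⁻¹`. Conversely, let a normalized `Φ` pull
back to `∂g`. On `Q` the cochain `g` is a 2-cocycle whose class is detected by its commutators on
simple roots. These come from a bicharacter of all of `P`, because `P` has real coordinates with
respect to the simple roots. Dividing by it and correcting by 1-cochains makes `g` trivial on `Q ×
Q` (`exists_trivial_on_free`) and then on `P × Q` (`exists_adapted_cochain`). Now triviality of `Φ`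
with one argument in `Q` says that `g⁻¹` is `Q`-invariant on the right and that a shift by `α_i` on
the left multiplies it by a character of `P` trivial on `Q`: it is one of the functions `f`
(`exists_phiTau_eq`).

If `P/Q` has two generators, then `P → P/Q` factors through `ℤ²` because `P` is free, so the
vanishing of `H³(ℤ²; 𝕋)` suffices (`exists_eq_coboundary_of_rank_two`). Dimension shifting turns the
3-cocycle into an extension of `ℤ²` by functions modulo constants. It splits once the two generators
have commuting lifts, and finding these is a difference equation.

For simple `𝔤`, the fundamental weights generate `P/Q` subject to the rows of the Cartan matrix.
`exists_two_generators` uses no classification. An entry `-1` in row `i` expresses one class through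
those at `i` and its other neighbours, so two classes propagate along the diagram as long as it has
no further branch or multiple bond. Such a second irregularity would produce an affine diagram, that
is, a vector of positive height and nonpositive square; `Loaded` carries one half of that vector
along the edges. -/

noncomputable section

/-! ## Generators of the cokernel of a connected positive definite Cartan matrix -/

namespace CartanCokernel

variable {κ : Type*}

/-- A realization of an integral matrix `A` with diagonal entries `2` and nonpositive off-diagonal
entries by vectors `α i` in a lattice with a symmetric form, for which `A i j = 2 (α i, α j) / (α j, α j)`
and which is positive on the vectors of positive height. -/
structure Realization (A : κ → κ → ℤ) (V : Type*) [AddCommGroup V] where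
  /-- The symmetric form. -/
  form : LinearMap.BilinForm ℤ V
  /-- The height function. -/
  height : V →ₗ[ℤ] ℤ
  /-- The vectors which are realized. -/
  vec : κ → V
  /-- Half of the square lengths. -/
  len : κ → ℤ
  diag : ∀ i, A i i = 2
  nonpos : ∀ i j, i ≠ j → A i j ≤ 0
  symm : ∀ x y, form x y = form y x
  form_vec : ∀ i j, form (vec i) (vec j) = A i j * len j
  len_pos : ∀ i, 0 < len i
  height_vec : ∀ i, height (vec i) = 1
  form_pos : ∀ v, 0 < height v → 0 < form v v

namespace Realization

variable {A : κ → κ → ℤ} {V : Type*} [AddCommGroup V] (R : Realization A V)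

theorem mul_len_comm (R : Realization A V) (i j : κ) : A i j * R.len j = A j i * R.len i := by
  rw [← R.form_vec, ← R.form_vec, R.symm]

theorem form_self (i : κ) : R.form (R.vec i) (R.vec i) = 2 * R.len i := by
  rw [R.form_vec, R.diag]

theorem form_nonpos {i j : κ} (h : i ≠ j) : R.form (R.vec i) (R.vec j) ≤ 0 := by
  rw [R.form_vec]
  exact mul_nonpos_of_nonpos_of_nonneg (R.nonpos i j h) (R.len_pos j).le

theorem eq_zero_symm (R : Realization A V) {i j : κ} (h : A i j = 0) : A j i = 0 := by
  have := R.mul_len_comm i j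
  rw [h, zero_mul, eq_comm, mul_eq_zero] at this
  exact this.resolve_right (R.len_pos i).ne'

/-- The right side equals `A i j * A j i * len i`, and a product of two negative integers is at
least 1. -/
theorem len_le_of_ne_zero {i j : κ} (h : i ≠ j) (ha : A i j ≠ 0) :
    R.len i ≤ A i j * (A i j * R.len j) := by
  have h1 : A i j ≤ -1 := by have := R.nonpos i j h; omega
  have h2 : A j i ≤ -1 := by
    have := R.nonpos j i h.symm
    have h3 : A j i ≠ 0 := fun h0 => ha (R.eq_zero_symm h0)
    omega
  rw [R.mul_len_comm i j, ← mul_assoc]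
  have h3 : 1 ≤ A i j * A j i := by nlinarith
  have := R.len_pos i
  nlinarith

/-- A certificate that the diagram, seen from the edge from `h` to `i`, has a triple bond, a double
bond or a branch behind `h`, or that there is such a bond between `h` and `i`. -/
def Loaded (h i : κ) : Prop :=
  ∃ y : V, 0 < R.height y ∧ R.form y y ≤ 4 * R.len i ∧ R.form y (R.vec i) ≤ 2 * R.len i ∧
    R.form y (R.vec h) ≤ 0 ∧
    ∀ k, k ≠ h → k ≠ i → R.form y (R.vec k) ≤ 2 * R.form (R.vec i) (R.vec k)

/-! ### Exclusion of affine diagrams by certificates moving along edges -/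

variable {R}

/-- The certificate `y` plays the part of half a null vector, with coefficient 2 at `i`. A multiple
bond beyond `i` closes it up: the square of `y - A i j • vec j` is at most `(4 - 2 * A i j * A j i)
* len i`. -/
theorem Loaded.mul_lt_two {h i j : κ} (H : R.Loaded h i) (hj : j ≠ h) (hij : j ≠ i) :
    A i j * A j i < 2 := by
  obtain ⟨y, y0, y1, -, -, y4⟩ := H
  by_contra! hm
  have hA := R.nonpos i j hij.symm
  have hp := R.form_pos (y - A i j • R.vec j) (by
    simp only [map_sub, map_smul, R.height_vec, smul_eq_mul]; omega)
  have e1 := y4 j hj hij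
  have e2 := R.form_self j
  have e3 := R.symm (R.vec j) y
  have e4 : A i j * (A i j * R.len j) = (A i j * A j i) * R.len i := by
    rw [R.mul_len_comm i j]; ring
  have e5 := R.form_vec i j
  have := R.len_pos i
  simp only [map_sub, map_smul, LinearMap.sub_apply, LinearMap.smul_apply, smul_eq_mul, e2, e3]
    at hp
  rw [e5] at e1
  nlinarith

theorem Loaded.eq_neg_one {h i j : κ} (H : R.Loaded h i) (hj : j ≠ h) (hij : j ≠ i)
    (ha : A i j ≠ 0) : A i j = -1 ∧ A j i = -1 := by
  have h0 := H.mul_lt_two hj hij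
  have h1 : A i j ≤ -1 := by have := R.nonpos i j hij.symm; omega
  have h2 : A j i ≤ -1 := by
    have := R.nonpos j i hij
    have h3 : A j i ≠ 0 := fun h0 => ha (R.eq_zero_symm h0)
    omega
  constructor <;> nlinarith

/-- A fork beyond `i` also closes up the null vector: each of the two neighbours lowers the bound `4
* len i` by at least `2 * len i`. -/
theorem Loaded.unique {h i j l : κ} (H : R.Loaded h i) (hj : j ≠ h) (hij : j ≠ i)
    (hl : l ≠ h) (hil : l ≠ i) (ha : A i j ≠ 0) (hb : A i l ≠ 0) : j = l := by
  obtain ⟨y, y0, y1, -, -, y4⟩ := H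
  by_contra hjl
  have hA := R.nonpos i j hij.symm
  have hB := R.nonpos i l hil.symm
  have hp := R.form_pos (y - A i j • R.vec j - A i l • R.vec l) (by
    simp only [map_sub, map_smul, R.height_vec, smul_eq_mul]; omega)
  have e1 := y4 j hj hij
  have f1 := y4 l hl hil
  have e4 := R.len_le_of_ne_zero hij.symm ha
  have f4 := R.len_le_of_ne_zero hil.symm hb
  have g := mul_nonpos_of_nonneg_of_nonpos
    (mul_nonneg_of_nonpos_of_nonpos hA hB) (R.form_nonpos hjl)
  rw [R.form_vec] at e1 f1
  simp only [map_sub, map_smul, LinearMap.sub_apply, LinearMap.smul_apply, smul_eq_mul,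
    R.form_self, R.symm (R.vec j) y, R.symm (R.vec l) y, R.symm (R.vec l) (R.vec j)] at hp
  nlinarith

/-- The bond is simple, so the lengths agree. Adding `2 • vec j` changes the square by `4 (y, vec j)
+ 8 len j ≤ 0`. -/
theorem Loaded.step {h i j : κ} (H : R.Loaded h i) (hj : j ≠ h) (hij : j ≠ i)
    (ha : A i j ≠ 0) : R.Loaded i j := by
  obtain ⟨h1, h2⟩ := H.eq_neg_one hj hij ha
  obtain ⟨y, y0, y1, y2, y3, y4⟩ := H
  have hl : R.len j = R.len i := by
    have := R.mul_len_comm i j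
    rw [h1, h2] at this
    omega
  have e := y4 j hj hij
  have e2 := R.form_self j
  have e3 := R.symm (R.vec j) y
  have e4 := R.form_vec i j
  have e5 := R.form_vec j i
  rw [h1] at e4
  rw [h2] at e5
  refine ⟨y + (2 : ℤ) • R.vec j, ?_, ?_, ?_, ?_, ?_⟩
  · simp only [map_add, map_smul, R.height_vec, smul_eq_mul]; omega
  · simp only [map_add, map_smul, LinearMap.add_apply, LinearMap.smul_apply, smul_eq_mul, e2, e3]
    omega
  · simp only [map_add, map_smul, LinearMap.add_apply, LinearMap.smul_apply, smul_eq_mul, e2]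
    omega
  · simp only [map_add, map_smul, LinearMap.add_apply, LinearMap.smul_apply, smul_eq_mul]
    omega
  · intro k hki hkj
    simp only [map_add, map_smul, LinearMap.add_apply, LinearMap.smul_apply, smul_eq_mul]
    have : R.form y (R.vec k) ≤ 0 := by
      rcases eq_or_ne k h with rfl | hk
      · exact y3
      · have := y4 k hk hki
        have := R.form_nonpos hki.symm
        omega
    omega

variable (R)

/-- The multiple bond is one end of an affine diagram. The coefficient `-A u v` makes the vector
orthogonal to `vec v`, and its square is `(8 - 2m) len u`, where `m ≥ 2` is the product of the two
entries. -/
theorem loaded_of_bond {v u : κ} (h : v ≠ u) (hm : 2 ≤ A v u * A u v) : R.Loaded v u := by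
  have hA := R.nonpos u v h.symm
  have e : A u v * (A u v * R.len v) = (A v u * A u v) * R.len u := by
    rw [R.mul_len_comm u v]; ring
  have hl := R.len_pos u
  have e1 := R.form_self u
  have e2 := R.form_self v
  have e3 := R.form_vec u v
  have e4 := R.symm (R.vec v) (R.vec u)
  refine ⟨(2 : ℤ) • R.vec u - A u v • R.vec v, ?_, ?_, ?_, ?_, ?_⟩
  · simp only [map_sub, map_smul, R.height_vec, smul_eq_mul]; omega
  · simp only [map_sub, map_smul, LinearMap.sub_apply, LinearMap.smul_apply, smul_eq_mul, e1, e2,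
      e4, e3]
    nlinarith
  · simp only [map_sub, map_smul, LinearMap.sub_apply, LinearMap.smul_apply, smul_eq_mul, e1,
      e4, e3]
    nlinarith
  · simp only [map_sub, map_smul, LinearMap.sub_apply, LinearMap.smul_apply, smul_eq_mul, e2, e3]
    nlinarith
  · intro k hk hku
    simp only [map_sub, map_smul, LinearMap.sub_apply, LinearMap.smul_apply, smul_eq_mul]
    have := mul_nonneg_of_nonpos_of_nonpos hA (R.form_nonpos hk.symm)
    omega

/-- All bonds of the diagram are simple. -/
def _root_.CartanCokernel.SimplyLaced (A : κ → κ → ℤ) : Prop :=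
  ∀ i j, i ≠ j → A i j ≠ 0 → A i j = -1

variable {R} in
theorem len_eq (hs : SimplyLaced A) {i j : κ} (h : i ≠ j) (ha : A i j ≠ 0) :
    R.len i = R.len j := by
  have := R.mul_len_comm i j
  rw [hs i j h ha, hs j i h.symm fun h0 => ha (R.eq_zero_symm h0)] at this
  omega

variable {R} in
theorem form_eq (hs : SimplyLaced A) {i j : κ} (h : i ≠ j) (ha : A i j ≠ 0) :
    R.form (R.vec i) (R.vec j) = -R.len i := by
  rw [R.form_vec, hs i j h ha, R.len_eq hs h ha]; ring

/-- The fork at `c` is one end of an affine diagram of type D: coefficient 1 at the legs `y`, `z`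
and 2 at `c`, `x`. -/
theorem loaded_of_branch (hs : SimplyLaced A) {c x y z : κ} (hx : c ≠ x) (hy : c ≠ y) (hz : c ≠ z)
    (hxy : x ≠ y) (hxz : x ≠ z) (hyz : y ≠ z) (ax : A c x ≠ 0) (ay : A c y ≠ 0) (az : A c z ≠ 0) :
    R.Loaded c x := by
  have lx := R.len_eq hs hx ax
  have ly := R.len_eq hs hy ay
  have lz := R.len_eq hs hz az
  have fx := R.form_eq hs hx ax
  have fy := R.form_eq hs hy ay
  have fz := R.form_eq hs hz az
  have sx := R.symm (R.vec x) (R.vec c)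
  have sy := R.symm (R.vec y) (R.vec c)
  have sz := R.symm (R.vec z) (R.vec c)
  have sxy := R.symm (R.vec y) (R.vec x)
  have sxz := R.symm (R.vec z) (R.vec x)
  have syz := R.symm (R.vec z) (R.vec y)
  have nxy := R.form_nonpos hxy
  have nxz := R.form_nonpos hxz
  have nyz := R.form_nonpos hyz
  have lp := R.len_pos c
  have qc := R.form_self c
  have qx := R.form_self x
  have qy := R.form_self y
  have qz := R.form_self z
  refine ⟨(2 : ℤ) • R.vec c + R.vec y + R.vec z + (2 : ℤ) • R.vec x, ?_, ?_, ?_, ?_, ?_⟩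
  · simp only [map_add, map_smul, R.height_vec, smul_eq_mul]; omega
  · simp only [map_add, map_smul, LinearMap.add_apply, LinearMap.smul_apply, smul_eq_mul]
    omega
  · simp only [map_add, map_smul, LinearMap.add_apply, LinearMap.smul_apply, smul_eq_mul]
    omega
  · simp only [map_add, map_smul, LinearMap.add_apply, LinearMap.smul_apply, smul_eq_mul]
    omega
  · intro k hkc hkx
    simp only [map_add, map_smul, LinearMap.add_apply, LinearMap.smul_apply, smul_eq_mul]
    rcases eq_or_ne k y with rfl | hky
    · omega
    rcases eq_or_ne k z with rfl | hkz
    · omega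
    have := R.form_nonpos hkc.symm
    have := R.form_nonpos hky.symm
    have := R.form_nonpos hkz.symm
    omega

/-- The vector is the null vector of affine D₄; bonds among the neighbours could only lower its
square. -/
theorem not_four_neighbours (R : Realization A V)
    (hs : SimplyLaced A) {c x y z t : κ} (hx : c ≠ x) (hy : c ≠ y)
    (hz : c ≠ z) (ht : c ≠ t) (hxy : x ≠ y) (hxz : x ≠ z) (hyz : y ≠ z) (hxt : x ≠ t) (hyt : y ≠ t)
    (hzt : z ≠ t) (ax : A c x ≠ 0) (ay : A c y ≠ 0) (az : A c z ≠ 0) (at' : A c t ≠ 0) : False := by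
  have hp := R.form_pos ((2 : ℤ) • R.vec c + R.vec x + R.vec y + R.vec z + R.vec t) (by
    simp only [map_add, map_smul, R.height_vec, smul_eq_mul]; omega)
  have lx := R.len_eq hs hx ax
  have ly := R.len_eq hs hy ay
  have lz := R.len_eq hs hz az
  have lt := R.len_eq hs ht at'
  have fx := R.form_eq hs hx ax
  have fy := R.form_eq hs hy ay
  have fz := R.form_eq hs hz az
  have ft := R.form_eq hs ht at'
  have n1 := R.form_nonpos hxy
  have n2 := R.form_nonpos hxz
  have n3 := R.form_nonpos hyz
  have n4 := R.form_nonpos hxt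
  have n5 := R.form_nonpos hyt
  have n6 := R.form_nonpos hzt
  have qc := R.form_self c
  have qx := R.form_self x
  have qy := R.form_self y
  have qz := R.form_self z
  have qt := R.form_self t
  simp only [map_add, map_smul, LinearMap.add_apply, LinearMap.smul_apply, smul_eq_mul,
    R.symm (R.vec x) (R.vec c), R.symm (R.vec y) (R.vec c), R.symm (R.vec z) (R.vec c),
    R.symm (R.vec t) (R.vec c), R.symm (R.vec y) (R.vec x), R.symm (R.vec z) (R.vec x),
    R.symm (R.vec z) (R.vec y), R.symm (R.vec t) (R.vec x), R.symm (R.vec t) (R.vec y),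
    R.symm (R.vec t) (R.vec z)] at hp
  linarith

/-- Affine A₂: the sum of the three vectors has square 0. -/
theorem not_triangle (R : Realization A V) (hs : SimplyLaced A) {c x y : κ} (hx : c ≠ x) (hy : c ≠ y) (hxy : x ≠ y)
    (ax : A c x ≠ 0) (ay : A c y ≠ 0) : A x y = 0 := by
  by_contra axy
  have hp := R.form_pos (R.vec c + R.vec x + R.vec y) (by
    simp only [map_add, R.height_vec]; omega)
  have lx := R.len_eq hs hx ax
  have ly := R.len_eq hs hy ay
  have fx := R.form_eq hs hx ax
  have fy := R.form_eq hs hy ay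
  have fxy := R.form_eq hs hxy axy
  have sx := R.symm (R.vec x) (R.vec c)
  have sy := R.symm (R.vec y) (R.vec c)
  have sxy := R.symm (R.vec y) (R.vec x)
  have qc := R.form_self c
  have qx := R.form_self x
  have qy := R.form_self y
  simp only [map_add, LinearMap.add_apply] at hp
  omega

/-- Affine A₃: the sum of the four vectors has square at most 0, whether or not there are diagonals.
-/
theorem not_square (R : Realization A V) (hs : SimplyLaced A) {c x y t : κ} (hx : c ≠ x) (hy : c ≠ y) (hxy : x ≠ y)
    (hct : c ≠ t) (hxt : x ≠ t) (hyt : y ≠ t)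
    (ax : A c x ≠ 0) (ay : A c y ≠ 0) (axt : A x t ≠ 0) : A y t = 0 := by
  by_contra ayt
  have hp := R.form_pos (R.vec c + R.vec x + R.vec y + R.vec t) (by
    simp only [map_add, R.height_vec]; omega)
  have lx := R.len_eq hs hx ax
  have ly := R.len_eq hs hy ay
  have lt := R.len_eq hs hxt axt
  have fx := R.form_eq hs hx ax
  have fy := R.form_eq hs hy ay
  have fxt := R.form_eq hs hxt axt
  have fyt := R.form_eq hs hyt ayt
  have nxy := R.form_nonpos hxy
  have nct := R.form_nonpos hct
  have sx := R.symm (R.vec x) (R.vec c)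
  have sy := R.symm (R.vec y) (R.vec c)
  have st := R.symm (R.vec t) (R.vec c)
  have sxy := R.symm (R.vec y) (R.vec x)
  have sxt := R.symm (R.vec t) (R.vec x)
  have syt := R.symm (R.vec t) (R.vec y)
  have qc := R.form_self c
  have qx := R.form_self x
  have qy := R.form_self y
  have qt := R.form_self t
  simp only [map_add, LinearMap.add_apply] at hp
  omega

/-- At least one of the arms at a branch vertex has length one. -/
theorem not_three_long_arms (R : Realization A V)
    (hs : SimplyLaced A) {c x y z x' y' z' : κ} (hx : c ≠ x) (hy : c ≠ y)
    (hz : c ≠ z) (hxy : x ≠ y) (hxz : x ≠ z) (hyz : y ≠ z) (hx' : x ≠ x') (hy' : y ≠ y')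
    (hz' : z ≠ z') (hcx' : c ≠ x') (hcy' : c ≠ y') (hcz' : c ≠ z')
    (ax : A c x ≠ 0) (ay : A c y ≠ 0) (az : A c z ≠ 0)
    (ax' : A x x' ≠ 0) (ay' : A y y' ≠ 0) (az' : A z z' ≠ 0) : False := by
  -- Without triangles and squares the vertices of the three arms are distinct, so the products not
  -- prescribed by the arms are nonpositive.
  have tri : ∀ {p q r : κ}, c ≠ p → c ≠ q → A c p ≠ 0 → A c q ≠ 0 → p ≠ r → A p r ≠ 0 → q ≠ r := by
    rintro p q r hp hq ap aq hpr apr rfl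
    exact apr (R.not_triangle hs hp hq hpr ap aq)
  have sq : ∀ {p q r s : κ}, c ≠ p → c ≠ q → p ≠ q → c ≠ r → p ≠ r → q ≠ s → A c p ≠ 0 → A c q ≠ 0 →
      A p r ≠ 0 → A q s ≠ 0 → r ≠ s := by
    rintro p q r s hp hq hpq hr hpr hqs ap aq apr aqs rfl
    exact aqs (R.not_square hs hp hq hpq hr hpr hqs ap aq apr)
  have n1 := R.form_nonpos hxy
  have n2 := R.form_nonpos hxz
  have n3 := R.form_nonpos hyz
  have n4 := R.form_nonpos hcx'
  have n5 := R.form_nonpos hcy'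
  have n6 := R.form_nonpos hcz'
  have n7 := R.form_nonpos (tri hx hy ax ay hx' ax')
  have n8 := R.form_nonpos (tri hx hz ax az hx' ax')
  have n9 := R.form_nonpos (tri hy hx ay ax hy' ay')
  have n10 := R.form_nonpos (tri hy hz ay az hy' ay')
  have n11 := R.form_nonpos (tri hz hx az ax hz' az')
  have n12 := R.form_nonpos (tri hz hy az ay hz' az')
  have n13 := R.form_nonpos (sq hx hy hxy hcx' hx' hy' ax ay ax' ay')
  have n14 := R.form_nonpos (sq hx hz hxz hcx' hx' hz' ax az ax' az')
  have n15 := R.form_nonpos (sq hy hz hyz hcy' hy' hz' ay az ay' az')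
  -- The coefficients 3, 2, 1 are the marks of affine E₆.
  have hp := R.form_pos ((3 : ℤ) • R.vec c + (2 : ℤ) • (R.vec x + R.vec y + R.vec z) +
    (R.vec x' + R.vec y' + R.vec z')) (by
    simp only [map_add, map_smul, R.height_vec, smul_eq_mul]; omega)
  have lx := R.len_eq hs hx ax
  have ly := R.len_eq hs hy ay
  have lz := R.len_eq hs hz az
  have lx' := R.len_eq hs hx' ax'
  have ly' := R.len_eq hs hy' ay'
  have lz' := R.len_eq hs hz' az'
  have fx := R.form_eq hs hx ax
  have fy := R.form_eq hs hy ay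
  have fz := R.form_eq hs hz az
  have fx' := R.form_eq hs hx' ax'
  have fy' := R.form_eq hs hy' ay'
  have fz' := R.form_eq hs hz' az'
  have qc := R.form_self c
  have qx := R.form_self x
  have qy := R.form_self y
  have qz := R.form_self z
  have qx' := R.form_self x'
  have qy' := R.form_self y'
  have qz' := R.form_self z'
  simp only [map_add, map_smul, LinearMap.add_apply, LinearMap.smul_apply, smul_eq_mul,
    R.symm (R.vec x) (R.vec c), R.symm (R.vec y) (R.vec c), R.symm (R.vec z) (R.vec c),
    R.symm (R.vec x') (R.vec c), R.symm (R.vec y') (R.vec c), R.symm (R.vec z') (R.vec c),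
    R.symm (R.vec y) (R.vec x), R.symm (R.vec z) (R.vec x), R.symm (R.vec z) (R.vec y),
    R.symm (R.vec x') (R.vec x), R.symm (R.vec y') (R.vec x), R.symm (R.vec z') (R.vec x),
    R.symm (R.vec x') (R.vec y), R.symm (R.vec y') (R.vec y), R.symm (R.vec z') (R.vec y),
    R.symm (R.vec x') (R.vec z), R.symm (R.vec y') (R.vec z), R.symm (R.vec z') (R.vec z),
    R.symm (R.vec y') (R.vec x'), R.symm (R.vec z') (R.vec x'), R.symm (R.vec z') (R.vec y')] at hp
  linarith

end Realization

end CartanCokernel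

/-! ### Propagation of generators along the diagram -/

namespace CartanCokernel

variable {κ : Type*}

/-- The oriented edges which are reached from the edges in `S` without turning back. -/
inductive Arm (A : κ → κ → ℤ) (S : κ → κ → Prop) : κ → κ → Prop
  | base {h i : κ} : S h i → Arm A S h i
  | step {h i j : κ} : Arm A S h i → j ≠ h → j ≠ i → A i j ≠ 0 → Arm A S i j

/-- Behind the edge from `h` to `i` there is at most one further edge, and it is simple from the
side of `i`. -/
def Unbranched (A : κ → κ → ℤ) (h i : κ) : Prop :=
  (∀ j, j ≠ h → j ≠ i → A i j ≠ 0 → A i j = -1) ∧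
    ∀ j l, j ≠ h → j ≠ i → l ≠ h → l ≠ i → A i j ≠ 0 → A i l ≠ 0 → j = l

section

variable {A : κ → κ → ℤ} {V : Type*} [AddCommGroup V] {R : Realization A V}

theorem Realization.Loaded.unbranched {h i : κ} (H : R.Loaded h i) : Unbranched A h i :=
  ⟨fun _ h1 h2 h3 => (H.eq_neg_one h1 h2 h3).1,
    fun _ _ h1 h2 h3 h4 h5 h6 => H.unique h1 h2 h3 h4 h5 h6⟩

theorem Realization.Loaded.of_arm {S : κ → κ → Prop} (hS : ∀ h i, S h i → R.Loaded h i) {h i : κ}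
    (H : Arm A S h i) : R.Loaded h i := by
  induction H with
  | base h => exact hS _ _ h
  | step _ h1 h2 h3 ih => exact ih.step h1 h2 h3

end

variable [Fintype κ] {Γ : Type*} [AddCommGroup Γ] {A : κ → κ → ℤ} {w : κ → Γ}

/-- The coefficient `-1` is invertible, so the relation of row `i` can be solved for `w j`. -/
theorem mem_of_relation (hw : ∀ i, ∑ j, A i j • w j = 0) (H : AddSubgroup Γ) {i j : κ}
    (hij : A i j = -1) (h : ∀ k, k ≠ j → A i k ≠ 0 → w k ∈ H) : w j ∈ H := by
  classical
  have h1 := hw i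
  rw [← Finset.add_sum_erase _ _ (Finset.mem_univ j), hij, neg_one_smul, neg_add_eq_zero] at h1
  rw [h1]
  refine sum_mem fun k hk => ?_
  by_cases h0 : A i k = 0
  · rw [h0, zero_smul]; exact zero_mem _
  · exact H.zsmul_mem (h k (Finset.ne_of_mem_erase hk) h0) _

/-- Propagation of membership along the arms starting at a set `C` of vertices. -/
theorem mem_of_arms (hA : ∀ i j, A i j = 0 → A j i = 0)
    (hconn : ∀ (p : κ → Prop) (i j : κ), p i → (∀ i j, p i → A j i ≠ 0 → p j) → p j)
    (hw : ∀ i, ∑ j, A i j • w j = 0) (H : AddSubgroup Γ) (C : κ → Prop) (S : κ → κ → Prop)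
    {c : κ} (hc : C c) (hCw : ∀ i, C i → w i ∈ H) (hSC : ∀ h i, S h i → C h)
    (hSw : ∀ h i, S h i → w i ∈ H)
    (hCS : ∀ i j, C i → A i j ≠ 0 → C j ∨ ∃ h, Arm A S h j)
    (hun : ∀ h i, Arm A S h i → Unbranched A h i) (i : κ) : w i ∈ H := by
  have key : ∀ h i, Arm A S h i → w h ∈ H ∧ w i ∈ H := by
    intro h i hi
    induction hi with
    | base hb => exact ⟨hCw _ (hSC _ _ hb), hSw _ _ hb⟩
    | @step h i j hi h1 h2 h3 ih =>
      refine ⟨ih.2, mem_of_relation hw H ((hun _ _ hi).1 j h1 h2 h3) fun k hk hik => ?_⟩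
      rcases eq_or_ne k h with rfl | hkh
      · exact ih.1
      rcases eq_or_ne k i with rfl | hki
      · exact ih.2
      exact absurd ((hun _ _ hi).2 j k h1 h2 hkh hki h3 hik) hk.symm
  -- These vertices are closed under adjacency: turning back leads to the tail of the last edge,
  -- which is the head of the previous edge or lies in `C`.
  have hX : C i ∨ ∃ h, Arm A S h i := by
    refine hconn (fun i => C i ∨ ∃ h, Arm A S h i) c i (Or.inl hc) ?_
    rintro i j hi hji
    have hij : A i j ≠ 0 := fun h => hji (hA _ _ h)
    rcases hi with hi | ⟨h, hi⟩
    · exact hCS i j hi hij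
    rcases eq_or_ne j i with rfl | hne
    · exact Or.inr ⟨h, hi⟩
    rcases eq_or_ne j h with rfl | hjh
    · cases hi with
      | base hb => exact Or.inl (hSC _ _ hb)
      | step hk _ _ _ => exact Or.inr ⟨_, hk⟩
    · exact Or.inr ⟨i, hi.step hjh hne hij⟩
  rcases hX with hi | ⟨h, hi⟩
  · exact hCw i hi
  · exact (key h i hi).2

/-- The cokernel of a connected Cartan matrix of finite type is generated by two elements. -/
theorem exists_two_generators {V : Type*} [AddCommGroup V] (R : Realization A V)
    (hconn : ∀ (p : κ → Prop) (i j : κ), p i → (∀ i j, p i → A j i ≠ 0 → p j) → p j)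
    (hw : ∀ i, ∑ j, A i j • w j = 0) :
    ∃ x y : Γ, ∀ i, w i ∈ AddSubgroup.closure {x, y} := by
  have hA : ∀ i j, A i j = 0 → A j i = 0 := fun i j h => R.eq_zero_symm h
  have gl : ∀ x y : Γ, x ∈ AddSubgroup.closure {x, y} := fun x y =>
    AddSubgroup.subset_closure (by simp)
  have gr : ∀ x y : Γ, y ∈ AddSubgroup.closure {x, y} := fun x y =>
    AddSubgroup.subset_closure (by simp)
  by_cases hs : SimplyLaced A
  swap
  · simp only [SimplyLaced, not_forall] at hs
    obtain ⟨u, v, huv, ha, hb⟩ := hs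
    have h1 := R.nonpos u v huv
    have h2 := R.nonpos v u huv.symm
    have h3 : A v u ≠ 0 := fun h => ha (hA _ _ h)
    have h4 : A u v ≤ -2 := by omega
    have h5 : A v u ≤ -1 := by omega
    have hm : 2 ≤ A u v * A v u := by nlinarith
    -- The ends of the multiple bond generate; arms leave it in both directions.
    let S : κ → κ → Prop := fun h i => (h = u ∧ i = v) ∨ (h = v ∧ i = u)
    refine ⟨w u, w v, mem_of_arms hA hconn hw _ (fun i => i = u ∨ i = v) S (Or.inl rfl) ?_ ?_ ?_ ?_
      fun h i hi => (Realization.Loaded.of_arm (R := R) ?_ hi).unbranched⟩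
    · rintro i (rfl | rfl)
      exacts [gl _ _, gr _ _]
    · rintro h i (⟨rfl, rfl⟩ | ⟨rfl, rfl⟩) <;> simp
    · rintro h i (⟨rfl, rfl⟩ | ⟨rfl, rfl⟩)
      exacts [gr _ _, gl _ _]
    · rintro i j hi hij
      by_cases hj : j = u ∨ j = v
      · exact Or.inl hj
      push Not at hj
      right
      rcases hi with rfl | rfl
      · exact ⟨i, Arm.step (Arm.base (Or.inr ⟨rfl, rfl⟩)) hj.2 hj.1 hij⟩
      · exact ⟨i, Arm.step (Arm.base (Or.inl ⟨rfl, rfl⟩)) hj.1 hj.2 hij⟩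
    · rintro h i (⟨rfl, rfl⟩ | ⟨rfl, rfl⟩)
      · exact R.loaded_of_bond huv hm
      · exact R.loaded_of_bond huv.symm (by rwa [mul_comm])
  have star : ∀ (c : κ) (H : AddSubgroup Γ), w c ∈ H → (∀ i, c ≠ i → A c i ≠ 0 → w i ∈ H) →
      (∀ h i, Arm A (fun h i => h = c ∧ c ≠ i ∧ A c i ≠ 0) h i → Unbranched A h i) →
      ∀ i, w i ∈ H := by
    intro c H hc hn hun
    refine mem_of_arms hA hconn hw H (fun i => i = c) (fun h i => h = c ∧ c ≠ i ∧ A c i ≠ 0)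
      rfl ?_ ?_ ?_ ?_ hun
    · rintro i rfl; exact hc
    · rintro h i ⟨rfl, -⟩; rfl
    · rintro h i ⟨rfl, h1, h2⟩; exact hn i h1 h2
    · rintro i j rfl hij
      rcases eq_or_ne i j with rfl | hne
      · exact Or.inl rfl
      · exact Or.inr ⟨i, Arm.base ⟨rfl, hne, hij⟩⟩
  by_cases hbr : ∃ c x y z : κ, c ≠ x ∧ c ≠ y ∧ c ≠ z ∧ x ≠ y ∧ x ≠ z ∧ y ≠ z ∧ A c x ≠ 0 ∧
      A c y ≠ 0 ∧ A c z ≠ 0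
  -- Since affine E₆ is excluded, some arm at the branch vertex consists of a single leaf `z`.
  · have hleaf : ∃ c x y z : κ, c ≠ x ∧ c ≠ y ∧ c ≠ z ∧ x ≠ y ∧ x ≠ z ∧ y ≠ z ∧ A c x ≠ 0 ∧
        A c y ≠ 0 ∧ A c z ≠ 0 ∧ ∀ k, z ≠ k → A z k ≠ 0 → k = c := by
      obtain ⟨c, x, y, z, hx, hy, hz, hxy, hxz, hyz, ax, ay, az⟩ := hbr
      by_contra hcon
      push Not at hcon
      obtain ⟨x', h1, h2, h3⟩ := hcon c y z x hy hz hx hyz hxy.symm hxz.symm ay az ax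
      obtain ⟨y', h4, h5, h6⟩ := hcon c x z y hx hz hy hxz hxy hyz.symm ax az ay
      obtain ⟨z', h7, h8, h9⟩ := hcon c x y z hx hy hz hxy hxz hyz ax ay az
      exact R.not_three_long_arms hs hx hy hz hxy hxz hyz h1 h4 h7 h3.symm h6.symm h9.symm
        ax ay az h2 h5 h8
    obtain ⟨c, x, y, z, hx, hy, hz, hxy, hxz, hyz, ax, ay, az, hleaf⟩ := hleaf
    have hdeg : ∀ t, c ≠ t → A c t ≠ 0 → t = x ∨ t = y ∨ t = z := by
      intro t ht at'
      by_contra! hcon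
      obtain ⟨h1, h2, h3⟩ := hcon
      exact R.not_four_neighbours hs hx hy hz ht hxy hxz hyz h1.symm h2.symm h3.symm ax ay az at'
    -- The relation at the leaf gives `w c = 2 • w z`; the relation at `c` then yields `w y`.
    refine ⟨w z, w x, star c _ ?_ ?_ fun h i hi =>
      (Realization.Loaded.of_arm (R := R) ?_ hi).unbranched⟩
    · refine mem_of_relation hw _ (hs z c hz.symm fun h => az (hA _ _ h)) fun k hk hzk => ?_
      rcases eq_or_ne z k with rfl | h
      · exact gl _ _
      · exact absurd (hleaf k h hzk) hk
    · have hc : w c ∈ AddSubgroup.closure {w z, w x} := by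
        refine mem_of_relation hw _ (hs z c hz.symm fun h => az (hA _ _ h)) fun k hk hzk => ?_
        rcases eq_or_ne z k with rfl | h
        · exact gl _ _
        · exact absurd (hleaf k h hzk) hk
      intro i hi hci
      rcases hdeg i hi hci with rfl | rfl | rfl
      · exact gr _ _
      · refine mem_of_relation hw _ (hs c i hi hci) fun k hk hck => ?_
        rcases eq_or_ne c k with rfl | hne
        · exact hc
        rcases hdeg k hne hck with rfl | rfl | rfl
        exacts [gr _ _, absurd rfl hk, gl _ _]
      · exact gl _ _
    · rintro h i ⟨rfl, hi, hci⟩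
      rcases hdeg i hi hci with rfl | rfl | rfl
      · exact R.loaded_of_branch hs hi hy hz hxy hxz hyz hci ay az
      · exact R.loaded_of_branch hs hi hx hz hxy.symm hyz hxz hci ax az
      · exact R.loaded_of_branch hs hi hx hy hxz.symm hyz.symm hxy hci ax ay
  -- Every vertex now has at most two neighbours, so any adjacent pair generates; cycles need not be
  -- excluded.
  · push Not at hbr
    by_cases hκ : IsEmpty κ
    · exact ⟨0, 0, fun i => isEmptyElim i⟩
    rw [not_isEmpty_iff] at hκ
    obtain ⟨c⟩ := hκ
    have hun : ∀ h i, Arm A (fun h i => h = c ∧ c ≠ i ∧ A c i ≠ 0) h i → Unbranched A h i := by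
      intro h i hi
      have hih : i ≠ h ∧ A i h ≠ 0 := by
        cases hi with
        | base hb =>
          obtain ⟨rfl, h1, h2⟩ := hb
          exact ⟨h1.symm, fun h => h2 (hA _ _ h)⟩
        | step _ _ h2 h3 => exact ⟨h2, fun h => h3 (hA _ _ h)⟩
      refine ⟨fun j _ h2 h3 => hs i j h2.symm h3, fun j l h1 h2 h3 h4 h5 h6 => ?_⟩
      by_contra hjl
      exact h6 (hbr i h j l hih.1 h2.symm h4.symm h1.symm h3.symm hjl hih.2 h5)
    by_cases hx : ∃ x, c ≠ x ∧ A c x ≠ 0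
    · obtain ⟨x, hx, ax⟩ := hx
      refine ⟨w c, w x, star c _ (gl _ _) (fun y hy ay => ?_) hun⟩
      rcases eq_or_ne y x with rfl | hyx
      · exact gr _ _
      refine mem_of_relation hw _ (hs c y hy ay) fun k hk hck => ?_
      rcases eq_or_ne c k with rfl | hne
      · exact gl _ _
      rcases eq_or_ne k x with rfl | hkx
      · exact gr _ _
      exact absurd (hbr c x y k hx hy hne hyx.symm hkx.symm hk.symm ax ay) hck
    · push Not at hx
      exact ⟨w c, w c, star c _ (gl _ _) (fun y hy ay => absurd (hx y hy) ay) hun⟩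

/-- A positive definite Cartan matrix has a realization. -/
theorem exists_realization [DecidableEq κ] {A : Matrix κ κ ℤ} {d : κ → ℤ} (hd : ∀ i, 0 < d i)
    (hpos : (A * Matrix.diagonal d).PosDef) (diag : ∀ i, A i i = 2)
    (nonpos : ∀ i j, i ≠ j → A i j ≤ 0) : Nonempty (Realization (fun i j => A i j) (κ → ℤ)) := by
  have hp := Matrix.posDef_iff_dotProduct_mulVec.1 hpos
  refine ⟨⟨Matrix.toBilin' (A * Matrix.diagonal d), ∑ i, LinearMap.proj i,
    fun i => Pi.single i 1, d, diag, nonpos, ?_, ?_, hd, ?_, ?_⟩⟩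
  · intro x y
    have hs : (A * Matrix.diagonal d).IsSymm := by
      simpa [Matrix.IsHermitian, Matrix.IsSymm] using hp.1
    rw [Matrix.toBilin'_apply', Matrix.toBilin'_apply', Matrix.dotProduct_mulVec,
      ← Matrix.mulVec_transpose, hs.eq, dotProduct_comm]
  · intro i j
    rw [Matrix.toBilin'_single, Matrix.mul_diagonal]
  · intro i
    simp [LinearMap.sum_apply]
  · intro v hv
    have hv0 : v ≠ 0 := by
      rintro rfl
      simp at hv
    simpa [Matrix.toBilin'_apply'] using hp.2 hv0

end CartanCokernel

/-! ## The weight lattice is freely generated by the fundamental weights -/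

namespace RootDatum

set_option linter.unusedSectionVars false

variable {ι k M N : Type*} [Field k] [CharZero k] [AddCommGroup M] [Module k M]
  [AddCommGroup N] [Module k N] {R : RootPairing ι k M N} [R.IsRootSystem] (b : R.Base)

theorem toLinearMap_coroot_injective (b : R.Base) {x y : M}
    (h : ∀ j : b.support, R.toLinearMap x (R.coroot j) = R.toLinearMap y (R.coroot j)) : x = y := by
  apply R.toLinearMap.toPerfPair.injective
  refine b.toCoweightBasis.ext fun j => ?_
  simpa using h j

/-- The fundamental weights, as vectors. -/
def fundamentalVec (i : b.support) : M :=
  R.toLinearMap.toPerfPair.symm (b.toCoweightBasis.coord i)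

theorem fundamentalVec_coroot [DecidableEq b.support] (i j : b.support) :
    R.toLinearMap (fundamentalVec b i) (R.coroot j) = if i = j then 1 else 0 := by
  have h : R.toLinearMap (fundamentalVec b i) = b.toCoweightBasis.coord i :=
    R.toLinearMap.toPerfPair.apply_symm_apply _
  rw [h, ← b.toCoweightBasis_apply j, Module.Basis.coord_apply, Module.Basis.repr_self,
    Finsupp.single_apply]
  simp only [eq_comm]

omit [R.IsRootSystem] in
-- Every coroot is an integral combination of simple coroots.
theorem mem_weightLattice_of_simple {x : M}
    (h : ∀ j : b.support, ∃ n : ℤ, R.toLinearMap x (R.coroot j) = (n : k)) :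
    x ∈ weightLattice R := by
  intro i
  have hi := b.coroot_mem_span_int i
  generalize R.coroot i = c at hi ⊢
  induction hi using Submodule.span_induction with
  | mem y hy => obtain ⟨j, hj, rfl⟩ := hy; exact h ⟨j, hj⟩
  | zero => exact ⟨0, by simp⟩
  | add y z _ _ hy hz =>
    obtain ⟨m, hm⟩ := hy
    obtain ⟨n, hn⟩ := hz
    exact ⟨m + n, by simp [hm, hn]⟩
  | smul a y _ hy =>
    obtain ⟨m, hm⟩ := hy
    exact ⟨a * m, by simp [hm]⟩

/-- The fundamental weights. -/
def fundamentalWeight (i : b.support) : weightLattice R :=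
  ⟨fundamentalVec b i, mem_weightLattice_of_simple b fun j => by
    classical
    rw [fundamentalVec_coroot]
    exact ⟨if i = j then 1 else 0, by split_ifs <;> simp⟩⟩

theorem sum_fundamentalWeight_coroot (n : b.support → ℤ) (j : b.support) :
    R.toLinearMap ((∑ i, n i • fundamentalWeight b i : weightLattice R) : M) (R.coroot j) = n j := by
  classical
  rw [AddSubgroup.val_finsetSum, map_sum, LinearMap.sum_apply]
  simp only [AddSubgroup.coe_zsmul, fundamentalWeight, map_zsmul, LinearMap.smul_apply,
    fundamentalVec_coroot]
  simp

theorem sum_fundamentalWeight_eq {n : b.support → ℤ} {x : weightLattice R}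
    (h : ∀ j : b.support, R.toLinearMap (x : M) (R.coroot j) = n j) :
    ∑ i, n i • fundamentalWeight b i = x :=
  Subtype.ext <| toLinearMap_coroot_injective b fun j => by rw [sum_fundamentalWeight_coroot, h]

/-- The coordinates of weights with respect to the fundamental weights. -/
def weightEquiv : (b.support → ℤ) ≃+ weightLattice R :=
  AddEquiv.ofBijective (M := b.support → ℤ) (N := weightLattice R)
    (F := (b.support → ℤ) →+ weightLattice R)
    { toFun := fun n => ∑ i, n i • fundamentalWeight b i
      map_zero' := by simp
      map_add' := fun m n => by simp [add_smul, Finset.sum_add_distrib] }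
    ⟨fun m n h => funext fun j => by
      have h1 := sum_fundamentalWeight_coroot b m j
      have h2 : ∑ i, m i • fundamentalWeight b i = ∑ i, n i • fundamentalWeight b i := h
      rw [h2, sum_fundamentalWeight_coroot] at h1
      exact_mod_cast h1.symm,
    fun x => ⟨fun j => (x.2 j).choose,
      sum_fundamentalWeight_eq b fun j => (x.2 j).choose_spec⟩⟩

theorem free_weightLattice (b : R.Base) : Module.Free ℤ (weightLattice R) :=
  Module.Free.of_equiv (weightEquiv b).toIntLinearEquiv

variable [R.IsCrystallographic]

/-- Modulo `Q` this is the relation that feeds `exists_two_generators`. -/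
theorem sum_cartanMatrix_fundamentalWeight (i : b.support) :
    ∑ j, b.cartanMatrix i j • fundamentalWeight b j = rootWeight R i :=
  sum_fundamentalWeight_eq b fun j => by
    rw [← eq_intCast (algebraMap ℤ k), b.algebraMap_cartanMatrixIn_apply ℤ i j]
    exact R.root_coroot_eq_pairing i j

theorem exists_two_generators_weightModRoot [Finite ι] [R.IsReduced] [R.IsIrreducible]
    (b : R.Base) :
    ∃ x y : WeightModRoot R, AddSubgroup.closure {x, y} = ⊤ := by
  classical
  obtain ⟨d, hd, hpos⟩ := b.exists_cartanMatrix_mul_diagaonal_posDef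
  obtain ⟨Z⟩ := CartanCokernel.exists_realization hd hpos b.cartanMatrix_apply_same
    b.cartanMatrix_le_zero_of_ne
  obtain ⟨x, y, h⟩ := CartanCokernel.exists_two_generators (Γ := WeightModRoot R)
    (w := fun j => (fundamentalWeight b j : WeightModRoot R)) Z
    (fun p i j hi hp => b.induction_on_cartanMatrix p hi hp) (fun i => by
      have h := congrArg (QuotientAddGroup.mk' (rootLattice R))
        (sum_cartanMatrix_fundamentalWeight b i)
      rw [map_sum] at h
      simp only [map_zsmul, QuotientAddGroup.mk'_apply] at h
      rw [h, QuotientAddGroup.eq_zero_iff]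
      exact AddSubgroup.subset_closure ⟨i, rfl⟩)
  refine ⟨x, y, (AddSubgroup.eq_top_iff' _).2 fun z => ?_⟩
  induction z using QuotientAddGroup.induction_on with | _ z
  obtain ⟨n, rfl⟩ := (weightEquiv b).surjective z
  have e : ((weightEquiv b n : weightLattice R) : WeightModRoot R) =
      ∑ i, n i • (fundamentalWeight b i : WeightModRoot R) := by
    change QuotientAddGroup.mk' (rootLattice R) (∑ i, n i • fundamentalWeight b i) = _
    rw [map_sum]
    simp only [map_zsmul, QuotientAddGroup.mk'_apply]
  rw [e]
  exact sum_mem fun i _ => AddSubgroup.zsmul_mem _ (h i) _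

end RootDatum

/-! ## Group extensions with free abelian quotient -/

/-- A factor set for an extension of the abelian group `G` by the abelian group `K`. -/
structure FactorSet (G K : Type*) [AddCommGroup G] [CommGroup K] where
  /-- The action of `G` on `K`. -/
  act : G → K →* K
  /-- The `2`-cocycle. -/
  cocycle : G → G → K
  act_zero : ∀ x, act 0 x = x
  act_add : ∀ a b x, act (a + b) x = act a (act b x)
  cocycle_eq : ∀ a b c, act a (cocycle b c) * cocycle a (b + c) = cocycle a b * cocycle (a + b) c

namespace FactorSet

variable {G K : Type*} [AddCommGroup G] [CommGroup K] (S : FactorSet G K)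

/-- The extension defined by a factor set. -/
@[ext] structure Ext (S : FactorSet G K) where
  /-- The component in the kernel. -/
  val : K
  /-- The component in the quotient. -/
  base : G

/-- Factor sets are not normalized; this is why `(cocycle 0 0)⁻¹` over `0` is a left unit of the
extension. -/
theorem cocycle_zero_left (a : G) : S.cocycle 0 a = S.cocycle 0 0 := by
  have := S.cocycle_eq 0 0 a
  rwa [S.act_zero, zero_add, zero_add, mul_left_inj] at this

instance : Mul S.Ext := ⟨fun x y => ⟨x.val * S.act x.base y.val * S.cocycle x.base y.base, x.base + y.base⟩⟩

instance : One S.Ext := ⟨⟨(S.cocycle 0 0)⁻¹, 0⟩⟩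

instance : Inv S.Ext :=
  ⟨fun x => ⟨(S.cocycle 0 0)⁻¹ * (S.act (-x.base) x.val * S.cocycle (-x.base) x.base)⁻¹, -x.base⟩⟩

theorem mul_val (x y : S.Ext) :
    (x * y).val = x.val * S.act x.base y.val * S.cocycle x.base y.base := rfl

theorem mul_base (x y : S.Ext) : (x * y).base = x.base + y.base := rfl

instance : Group S.Ext :=
  Group.ofLeftAxioms
    (fun x y z => by
      refine Ext.ext ?_ (add_assoc _ _ _)
      simp only [mul_val, mul_base, map_mul, S.act_add]
      have h := congrArg Additive.ofMul (S.cocycle_eq x.base y.base z.base)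
      apply Additive.ofMul.injective
      simp only [ofMul_mul] at h ⊢
      linear_combination (norm := abel) -h)
    (fun x => by
      refine Ext.ext ?_ (zero_add _)
      change (S.cocycle 0 0)⁻¹ * S.act 0 x.val * S.cocycle 0 x.base = x.val
      rw [S.act_zero, S.cocycle_zero_left x.base, mul_right_comm, inv_mul_cancel, one_mul])
    (fun x => by
      refine Ext.ext ?_ (neg_add_cancel _)
      change (S.cocycle 0 0)⁻¹ * (S.act (-x.base) x.val * S.cocycle (-x.base) x.base)⁻¹ *
        S.act (-x.base) x.val * S.cocycle (-x.base) x.base = (S.cocycle 0 0)⁻¹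
      rw [mul_assoc, mul_assoc, inv_mul_cancel, mul_one])

/-- The projection of the extension onto the quotient. -/
def toBase : S.Ext →* Multiplicative G where
  toFun x := Multiplicative.ofAdd x.base
  map_one' := rfl
  map_mul' _ _ := rfl

/-- An extension of `ℤ ^ κ` splits if the generators have commuting lifts. -/
theorem exists_section {κ : Type*} [Fintype κ] [DecidableEq κ] (S : FactorSet (κ → ℤ) K)
    (X : κ → S.Ext) (hX : ∀ i, (X i).base = Pi.single i 1) (hc : ∀ i j, Commute (X i) (X j)) :
    ∃ u : (κ → ℤ) → K, ∀ m n, u (m + n) = u m * S.act m (u n) * S.cocycle m n := by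
  -- Commuting lifts extend to a homomorphism. It is a section of the projection, and its
  -- `K`-component is `u`.
  let ψ : (κ → Multiplicative ℤ) →* S.Ext :=
    MonoidHom.noncommPiCoprod (fun i => zpowersHom _ (X i)) fun i j _ x y => by
      simp only [zpowersHom_apply]
      exact (hc i j).zpow_zpow _ _
  let T : (κ → Multiplicative ℤ) →* Multiplicative (κ → ℤ) :=
    { toFun := fun n => Multiplicative.ofAdd fun i => (n i).toAdd
      map_one' := rfl
      map_mul' := fun _ _ => rfl }
  have hT : S.toBase.comp ψ = T := by
    refine MonoidHom.functions_ext _ _ _ fun i y => ?_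
    rw [MonoidHom.comp_apply]
    have h1 : ψ (Pi.mulSingle i y) = X i ^ y.toAdd := by
      exact MonoidHom.noncommPiCoprod_mulSingle (N := fun _ => Multiplicative ℤ) _ i y
    rw [h1, map_zpow]
    have h2 : S.toBase (X i) = Multiplicative.ofAdd (Pi.single i 1) :=
      congrArg Multiplicative.ofAdd (hX i)
    rw [h2, ← ofAdd_zsmul]
    refine congrArg Multiplicative.ofAdd (funext fun j => ?_)
    rcases eq_or_ne j i with rfl | h
    · simp
    · simp [h]
  have hb : ∀ n : κ → ℤ, (ψ fun i => Multiplicative.ofAdd (n i)).base = n := fun n =>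
    congrArg Multiplicative.toAdd (DFunLike.congr_fun hT fun i => Multiplicative.ofAdd (n i))
  refine ⟨fun n => (ψ fun i => Multiplicative.ofAdd (n i)).val, fun m n => ?_⟩
  have h := congrArg Ext.val (map_mul ψ (fun i => Multiplicative.ofAdd (m i))
    fun i => Multiplicative.ofAdd (n i))
  rw [mul_val, hb, hb] at h
  exact h

end FactorSet

/-! ## Three-cocycles -/

namespace CircleCochain

variable {A : Type*} [AddCommGroup A]

theorem IsCocycle.mul_inv {Φ Ψ : A → A → A → Circle} (h : IsCocycle Φ) (h' : IsCocycle Ψ) :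
    IsCocycle fun a b c => Φ a b c * (Ψ a b c)⁻¹ := by
  intro a b c d
  have h1 := congrArg Additive.ofMul (h a b c d)
  have h2 := congrArg Additive.ofMul (h' a b c d)
  apply Additive.ofMul.injective
  simp only [ofMul_mul, ofMul_inv, ofMul_one] at h1 h2 ⊢
  linear_combination (norm := abel) h1 - h2

theorem coboundary_mul (f g : A → A → Circle) (a b c : A) :
    coboundary (fun x y => f x y * g x y) a b c = coboundary f a b c * coboundary g a b c := by
  apply Additive.ofMul.injective
  simp only [coboundary, ofMul_mul, ofMul_inv]
  abel

theorem coboundary_inv (f : A → A → Circle) (a b c : A) :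
    coboundary (fun x y => (f x y)⁻¹) a b c = (coboundary f a b c)⁻¹ := by
  apply Additive.ofMul.injective
  simp only [coboundary, ofMul_mul, ofMul_inv]
  abel

/-- The coboundary of a coboundary is trivial. -/
theorem coboundary_coboundary (k : A → Circle) (a b c : A) :
    coboundary (fun x y => k x * k y * (k (x + y))⁻¹) a b c = 1 := by
  apply Additive.ofMul.injective
  simp only [coboundary, ofMul_mul, ofMul_inv, ofMul_one, add_assoc]
  abel

theorem Cohomologous.symm {Φ Ψ : A → A → A → Circle} (h : Cohomologous Φ Ψ) :
    Cohomologous Ψ Φ := by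
  obtain ⟨g, hg⟩ := h
  exact ⟨fun x y => (g x y)⁻¹, fun a b c => by rw [coboundary_inv, hg, mul_inv_cancel_right]⟩

theorem Cohomologous.liftsToCoboundary {N : AddSubgroup A} {Φ Ψ : A ⧸ N → A ⧸ N → A ⧸ N → Circle}
    (h : Cohomologous Φ Ψ) (hΨ : LiftsToCoboundary Ψ) : LiftsToCoboundary Φ := by
  obtain ⟨g, hg⟩ := h
  obtain ⟨k, hk⟩ := hΨ
  exact ⟨fun x y => k x y * g x y, fun a b c => by rw [coboundary_mul, hg, hk]; rfl⟩

/-- A normalized cochain: it is trivial as soon as one of the arguments is. -/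
structure IsNormalized (Φ : A → A → A → Circle) : Prop where
  left : ∀ a b, Φ 0 a b = 1
  mid : ∀ a b, Φ a 0 b = 1
  right : ∀ a b, Φ a b 0 = 1

/-- Every `3`-cocycle is cohomologous to a normalized one. -/
theorem IsCocycle.exists_normalized {Φ : A → A → A → Circle} (h : IsCocycle Φ) :
    ∃ Ψ, IsCocycle Ψ ∧ IsNormalized Ψ ∧ Cohomologous Φ Ψ := by
  -- Chosen so that `∂g` agrees with `Φ` at `(0, 0, c)` and `(a, 0, 0)`; the cocycle identity forces
  -- the remaining normalizations.
  let g : A → A → Circle := fun a c => Φ 0 0 c * (Φ a 0 0)⁻¹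
  let Ψ : A → A → A → Circle := fun a b c => Φ a b c * (coboundary g a b c)⁻¹
  have hΨ : IsCocycle Ψ := h.mul_inv (isCocycle_coboundary g)
  have h0 : Φ 0 0 0 = 1 := by simpa using h 0 0 0 0
  have hl : ∀ c, Ψ 0 0 c = 1 := fun c => by simp [Ψ, g, coboundary, h0]
  have hr : ∀ a, Ψ a 0 0 = 1 := fun a => by simp [Ψ, g, coboundary, h0]
  refine ⟨Ψ, hΨ, ⟨fun b c => ?_, fun a c => ?_, fun a b => ?_⟩, g, fun a b c => by simp [Ψ]⟩
  · simpa [hl] using hΨ 0 0 b c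
  · simpa [hl, hr] using hΨ a 0 0 c
  · simpa [hr] using hΨ a b 0 0

/-! ### Cocycles which lift to a coboundary -/

variable {κ : Type*} [Fintype κ]

/-- Place the arguments of `ω` above the diagonal for some ordering of `κ` and exponentiate the
bilinear form. The real coordinates `x i` define it on all of `A`, not only on the span of the `e
i`. -/
theorem exists_bicharacter (e : κ → A) (x : κ → A →+ ℝ) (hxe : ∀ i, x i (e i) = 1)
    (hxe' : ∀ i j, i ≠ j → x i (e j) = 0) (ω : κ → κ → Circle) (hω : ∀ i, ω i i = 1)
    (hω' : ∀ i j, ω j i = (ω i j)⁻¹) :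
    ∃ B : A → A → Circle, (∀ a b c, B (a + b) c = B a c * B b c) ∧
      (∀ a b c, B a (b + c) = B a b * B a c) ∧
      ∀ i j, B (e i) (e j) * (B (e j) (e i))⁻¹ = ω i j := by
  classical
  let ρ := Fintype.equivFin κ
  let θ : κ → κ → ℝ := fun i j => if ρ i < ρ j then Complex.arg (ω i j) else 0
  have hB : ∀ i j, ∑ k, ∑ l, θ k l * x k (e i) * x l (e j) = θ i j := by
    intro i j
    rw [Finset.sum_eq_single i, Finset.sum_eq_single j]
    · rw [hxe, hxe]; ring
    · intro l _ hl; rw [hxe' l j hl, mul_zero]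
    · simp
    · intro k _ hk; simp [hxe' k i hk]
    · simp
  have hθ : ∀ i j, ρ i < ρ j → Circle.exp (θ i j) = ω i j := fun i j h => by
    simp only [θ, if_pos h]; exact Circle.exp_arg _
  have hθ' : ∀ i j, ¬ ρ i < ρ j → Circle.exp (θ i j) = 1 := fun i j h => by
    simp only [θ, if_neg h]; exact Circle.exp_zero
  refine ⟨fun a b => Circle.exp (∑ k, ∑ l, θ k l * x k a * x l b), ?_, ?_, fun i j => ?_⟩
  · intro a b c
    rw [← Circle.exp_add]
    simp only [map_add, mul_add, add_mul, Finset.sum_add_distrib]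
  · intro a b c
    rw [← Circle.exp_add]
    simp only [map_add, mul_add, Finset.sum_add_distrib]
  · beta_reduce
    rw [hB, hB]
    rcases lt_trichotomy (ρ i) (ρ j) with h | h | h
    · rw [hθ _ _ h, hθ' _ _ h.not_gt, inv_one, mul_one]
    · obtain rfl := ρ.injective h
      rw [mul_inv_cancel, hω]
    · rw [hθ _ _ h, hθ' _ _ h.not_gt, one_mul, hω' i j, inv_inv]

theorem coboundary_bicharacter {B : A → A → Circle} (h1 : ∀ a b c, B (a + b) c = B a c * B b c)
    (h2 : ∀ a b c, B a (b + c) = B a b * B a c) (a b c : A) : coboundary B a b c = 1 := by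
  apply Additive.ofMul.injective
  simp only [coboundary, h1, h2, ofMul_mul, ofMul_inv, ofMul_one]
  abel

/-- A `2`-cochain on `A` which is a cocycle on the free subgroup generated by the `e i` can be
changed by a cocycle on `A` so that it becomes trivial on this subgroup. -/
theorem exists_trivial_on_free (e : κ → A) (x : κ → A →+ ℝ) (hxe : ∀ i, x i (e i) = 1)
    (hxe' : ∀ i j, i ≠ j → x i (e j) = 0) (g : A → A → Circle)
    (hg : ∀ a ∈ AddSubgroup.closure (Set.range e), ∀ b ∈ AddSubgroup.closure (Set.range e),
      ∀ c ∈ AddSubgroup.closure (Set.range e), coboundary g a b c = 1) :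
    ∃ g' : A → A → Circle, (∀ a b c, coboundary g' a b c = coboundary g a b c) ∧
      ∀ a ∈ AddSubgroup.closure (Set.range e), ∀ b ∈ AddSubgroup.closure (Set.range e),
        g' a b = 1 := by
  classical
  -- On the free subgroup `g` defines a central extension. Division by `B` cancels the commutators
  -- of the lifted generators without changing `∂g`.
  obtain ⟨B, hB1, hB2, hB⟩ := exists_bicharacter e x hxe hxe'
    (fun i j => g (e i) (e j) * (g (e j) (e i))⁻¹) (fun i => mul_inv_cancel _)
    (fun i j => by simp)
  let φ : (κ → ℤ) →+ A :=
    { toFun := fun n => ∑ i, n i • e i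
      map_zero' := by simp
      map_add' := fun m n => by simp [add_smul, Finset.sum_add_distrib] }
  have hxφ : ∀ n i, x i (φ n) = n i := by
    intro n i
    change x i (∑ j, n j • e j) = n i
    rw [map_sum, Finset.sum_eq_single i]
    · rw [map_zsmul, hxe]; simp
    · intro j _ hj; rw [map_zsmul, hxe' i j hj.symm, smul_zero]
    · simp
  have hφ : Function.Injective φ := fun m n h => funext fun i => by
    have := hxφ m i
    rw [h, hxφ] at this
    exact_mod_cast this.symm
  have hφe : ∀ i, φ (Pi.single i 1) = e i := fun i => by
    change ∑ j, (Pi.single i 1 : κ → ℤ) j • e j = e i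
    rw [Finset.sum_eq_single i]
    · simp
    · intro j _ hj; simp [hj]
    · simp
  have hmem : ∀ a ∈ AddSubgroup.closure (Set.range e), ∃ n, φ n = a := by
    intro a ha
    have : AddSubgroup.closure (Set.range e) ≤ φ.range := by
      rw [AddSubgroup.closure_le]
      rintro _ ⟨i, rfl⟩
      exact ⟨_, hφe i⟩
    exact this ha
  have hmem' : ∀ n, φ n ∈ AddSubgroup.closure (Set.range e) := fun n =>
    sum_mem fun i _ => AddSubgroup.zsmul_mem _ (AddSubgroup.subset_closure (Set.mem_range_self i)) _
  let g₁ : A → A → Circle := fun a b => g a b * (B a b)⁻¹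
  have hg₁ : ∀ a b c, coboundary g₁ a b c = coboundary g a b c := fun a b c => by
    rw [coboundary_mul g (fun a b => (B a b)⁻¹), coboundary_inv,
      coboundary_bicharacter hB1 hB2, inv_one, mul_one]
  let S : FactorSet (κ → ℤ) Circle :=
    { act := fun _ => MonoidHom.id _
      cocycle := fun m n => g₁ (φ m) (φ n)
      act_zero := fun _ => rfl
      act_add := fun _ _ _ => rfl
      cocycle_eq := fun a b c => by
        have h := congrArg Additive.ofMul
          ((hg₁ _ _ _).trans (hg (φ a) (hmem' a) (φ b) (hmem' b) (φ c) (hmem' c)))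
        apply Additive.ofMul.injective
        simp only [MonoidHom.id_apply, map_add, coboundary, ofMul_mul, ofMul_inv,
          ofMul_one] at h ⊢
        linear_combination (norm := abel) h }
  obtain ⟨u, hu⟩ := S.exists_section (fun i => ⟨1, Pi.single i 1⟩) (fun _ => rfl) fun i j => by
    refine FactorSet.Ext.ext ?_ (add_comm _ _)
    change 1 * 1 * g₁ (φ (Pi.single i 1)) (φ (Pi.single j 1)) =
      1 * 1 * g₁ (φ (Pi.single j 1)) (φ (Pi.single i 1))
    have h := congrArg Additive.ofMul (hB i j)
    apply Additive.ofMul.injective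
    simp only [hφe, g₁, one_mul, ofMul_mul, ofMul_inv] at h ⊢
    linear_combination (norm := abel) -h
  -- The value 1 off the subgroup is arbitrary: `∂∂k = 1` for every `k`.
  let k : A → Circle := Function.extend φ u 1
  have hk : ∀ n, k (φ n) = u n := fun n => hφ.extend_apply _ _ _
  refine ⟨fun a b => g₁ a b * (k a * k b * (k (a + b))⁻¹), fun a b c => ?_, ?_⟩
  · rw [coboundary_mul g₁ fun a b => k a * k b * (k (a + b))⁻¹, coboundary_coboundary, mul_one, hg₁]
  · intro a ha b hb
    obtain ⟨m, rfl⟩ := hmem a ha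
    obtain ⟨n, rfl⟩ := hmem b hb
    have h : u (m + n) = u m * u n * g₁ (φ m) (φ n) := hu m n
    beta_reduce
    rw [← map_add, hk, hk, hk, h]
    apply Additive.ofMul.injective
    simp only [ofMul_mul, ofMul_inv, ofMul_one]
    abel

/-- A normalized cocycle on `A ⧸ N` which lifts to a coboundary is the coboundary of a cochain on
`A` which is trivial when the second argument is in `N`. -/
theorem exists_adapted_cochain (N : AddSubgroup A) (e : κ → A) (x : κ → A →+ ℝ)
    (hN : N = AddSubgroup.closure (Set.range e)) (hxe : ∀ i, x i (e i) = 1)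
    (hxe' : ∀ i j, i ≠ j → x i (e j) = 0) {Φ : A ⧸ N → A ⧸ N → A ⧸ N → Circle}
    (hΦ : IsNormalized Φ) (hlift : LiftsToCoboundary Φ) :
    ∃ g : A → A → Circle, (∀ a b c : A, Φ a b c = coboundary g a b c) ∧
      ∀ a, ∀ q ∈ N, g a q = 1 := by
  obtain ⟨g₀, hg₀⟩ := hlift
  have hz : ∀ q ∈ N, (q : A ⧸ N) = 0 := fun q hq => (QuotientAddGroup.eq_zero_iff q).2 hq
  obtain ⟨g, hg, hg1⟩ := exists_trivial_on_free e x hxe hxe' g₀ (by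
    rw [← hN]
    intro a ha b hb c hc
    rw [← hg₀, hz a ha, hΦ.left])
  rw [← hN] at hg1
  let r : A → A := fun a => Quotient.out (a : A ⧸ N)
  have hr : ∀ a, a - r a ∈ N := fun a => by
    rw [← QuotientAddGroup.eq_iff_sub_mem]
    exact (QuotientAddGroup.out_eq' _).symm
  have hrq : ∀ a, ∀ q ∈ N, r (a + q) = r a := fun a q hq => by
    simp only [r]
    rw [QuotientAddGroup.mk_add, hz q hq, add_zero]
  -- The identity `Φ (r a) (a - r a) q = 1` reads `g a q = k (a + q) / k a`, so the coboundary of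
  -- `k` cancels `g a q`.
  let k : A → Circle := fun a => g (r a) (a - r a)
  have hkq : ∀ q ∈ N, k q = 1 := fun q hq => by
    refine hg1 _ ?_ _ (hr q)
    have := N.sub_mem hq (hr q)
    rwa [sub_sub_cancel] at this
  refine ⟨fun a b => g a b * (k a * k b * (k (a + b))⁻¹), fun a b c => ?_, fun a q hq => ?_⟩
  · rw [coboundary_mul g fun a b => k a * k b * (k (a + b))⁻¹, coboundary_coboundary, mul_one, hg,
      hg₀]
  · have h := hg₀ (r a) (a - r a) q
    rw [hz q hq, hΦ.right, ← hg] at h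
    beta_reduce
    rw [hkq q hq]
    simp only [k, hrq a q hq]
    have h1 := hg1 _ (hr a) q hq
    have e1 : a + q - r a = a - r a + q := by abel
    rw [e1]
    have e2 : r a + (a - r a) = a := by abel
    simp only [coboundary, e2, h1] at h
    have h := congrArg Additive.ofMul h
    apply Additive.ofMul.injective
    simp only [ofMul_mul, ofMul_inv, ofMul_one] at h ⊢
    linear_combination (norm := abel) h

end CircleCochain

/-! ### Dimension shifting and degree three cohomology of `ℤ²` -/

namespace CircleCochain

variable {G : Type*} [AddCommGroup G]

variable (G) in
/-- The circle-valued functions with value `1` at `0`. -/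
def pointedFunctions : Subgroup (G → Circle) where
  carrier := {n | n 0 = 1}
  one_mem' := rfl
  mul_mem' := fun {m n} hm hn => by
    change m 0 * n 0 = 1
    rw [show m 0 = 1 from hm, show n 0 = 1 from hn, one_mul]
  inv_mem' := fun {n} hn => by
    change (n 0)⁻¹ = 1
    rw [show n 0 = 1 from hn, inv_one]

/-- The factor set with values in the circle-valued functions modulo constants obtained from a
normalized `3`-cocycle by dimension shifting. -/
def shiftFactorSet {Φ : G → G → G → Circle} (hΦ : IsCocycle Φ) (hn : IsNormalized Φ) :
    FactorSet G (pointedFunctions G) where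
  -- Classes modulo constants are represented by their members with value 1 at `0`, so a translate
  -- is renormalized by `n a`.
  act a :=
    { toFun := fun n => ⟨fun x => n.1 (x + a) * (n.1 a)⁻¹, by
        change n.1 (0 + a) * (n.1 a)⁻¹ = 1
        rw [zero_add, mul_inv_cancel]⟩
      map_one' := Subtype.ext (funext fun x => by simp)
      map_mul' := fun m n => Subtype.ext (funext fun x => by
        change m.1 (x + a) * n.1 (x + a) * (m.1 a * n.1 a)⁻¹ =
          m.1 (x + a) * (m.1 a)⁻¹ * (n.1 (x + a) * (n.1 a)⁻¹)
        rw [mul_inv, mul_mul_mul_comm]) }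
  cocycle a b := ⟨fun x => Φ x a b, hn.left a b⟩
  act_zero n := Subtype.ext (funext fun x => by
    change n.1 (x + 0) * (n.1 0)⁻¹ = n.1 x
    rw [add_zero, show n.1 0 = 1 from n.2, inv_one, mul_one])
  act_add a b n := Subtype.ext (funext fun x => by
    change n.1 (x + (a + b)) * (n.1 (a + b))⁻¹ =
      n.1 (x + a + b) * (n.1 b)⁻¹ * (n.1 (a + b) * (n.1 b)⁻¹)⁻¹
    rw [mul_inv, inv_inv, ← add_assoc]
    apply Additive.ofMul.injective
    simp only [ofMul_mul, ofMul_inv]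
    abel)
  cocycle_eq a b c := Subtype.ext (funext fun x => by
    change Φ (x + a) b c * (Φ a b c)⁻¹ * Φ x a (b + c) = Φ x a b * Φ x (a + b) c
    have h := congrArg Additive.ofMul (hΦ x a b c)
    apply Additive.ofMul.injective
    simp only [ofMul_mul, ofMul_inv, ofMul_one] at h ⊢
    linear_combination (norm := abel) -h)

theorem exists_int_primitive {K : Type*} [CommGroup K] (p : ℤ → K) :
    ∃ P : ℤ → K, P 0 = 1 ∧ ∀ k, P (k + 1) = P k * p k := by
  let P : ℤ → K := fun k => match k with
    | Int.ofNat n => ∏ i ∈ Finset.range n, p i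
    | Int.negSucc n => (∏ i ∈ Finset.range (n + 1), p (Int.negSucc i))⁻¹
  refine ⟨P, rfl, fun k => ?_⟩
  match k with
  | Int.ofNat n => exact Finset.prod_range_succ _ _
  | Int.negSucc 0 =>
    change (1 : K) = (∏ i ∈ Finset.range 1, p (Int.negSucc i))⁻¹ * p (Int.negSucc 0)
    rw [Finset.prod_range_one, inv_mul_cancel]
  | Int.negSucc (n + 1) =>
    change (∏ i ∈ Finset.range (n + 1), p (Int.negSucc i))⁻¹ =
      (∏ i ∈ Finset.range (n + 2), p (Int.negSucc i))⁻¹ * p (Int.negSucc (n + 1))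
    rw [Finset.prod_range_succ _ (n + 1), mul_inv, inv_mul_cancel_right]

/-- The third cohomology of `ℤ²` with values in the circle is trivial. -/
theorem exists_eq_coboundary_of_rank_two {Φ : (Fin 2 → ℤ) → (Fin 2 → ℤ) → (Fin 2 → ℤ) → Circle}
    (hΦ : IsCocycle Φ) (hn : IsNormalized Φ) : ∃ g, ∀ a b c, Φ a b c = coboundary g a b c := by
  let e : Fin 2 → Fin 2 → ℤ := fun i => Pi.single i 1
  -- `h` is the failure of the lifts `(1, e 0)` and `(1, e 1)` to commute. Replacing the first by
  -- `(n, e 0)` repairs it if `n (x + e 1) = n x * h x`, which is solved separately on each line in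
  -- direction `e 1`.
  let h : (Fin 2 → ℤ) → Circle := fun x => Φ x (e 0) (e 1) * (Φ x (e 1) (e 0))⁻¹
  have h0 : h 0 = 1 := by simp [h, hn.left]
  choose P hP0 hP using fun i : ℤ => exists_int_primitive fun k => h ![i, k]
  let n : (Fin 2 → ℤ) → Circle := fun x => P (x 0) (x 1)
  have hn0 : n 0 = 1 := hP0 0
  have hn1 : ∀ x, n (x + e 1) = n x * h x := fun x => by
    have e1 : (x + e 1) 0 = x 0 := by simp [e]
    have e2 : (x + e 1) 1 = x 1 + 1 := by simp [e]
    have e3 : ![x 0, x 1] = x := by ext i; fin_cases i <;> rfl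
    simp only [n]
    rw [e1, e2, hP, e3]
  let S := shiftFactorSet hΦ hn
  let X : Fin 2 → S.Ext := ![⟨⟨n, hn0⟩, e 0⟩, ⟨1, e 1⟩]
  have hX : Commute (X 0) (X 1) := by
    refine FactorSet.Ext.ext (Subtype.ext (funext fun x => ?_)) (add_comm _ _)
    change n x * (1 * 1⁻¹) * Φ x (e 0) (e 1) = 1 * (n (x + e 1) * (n (e 1))⁻¹) * Φ x (e 1) (e 0)
    have h1 : n (e 1) = 1 := by simpa [hn0, h0] using hn1 0
    rw [hn1, h1]
    simp [h, mul_assoc]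
  obtain ⟨u, hu⟩ := S.exists_section X (fun i => by fin_cases i <;> rfl) (fun i j => by
    fin_cases i <;> fin_cases j
    exacts [Commute.refl _, hX, hX.symm, Commute.refl _])
  -- This undoes the dimension shift.
  refine ⟨fun x b => (u b).1 x, fun x b c => ?_⟩
  have h : (u (b + c)).1 x = (u b).1 x * ((u c).1 (x + b) * ((u c).1 b)⁻¹) * Φ x b c :=
    congrFun (congrArg Subtype.val (hu b c)) x
  have h := congrArg Additive.ofMul h
  apply Additive.ofMul.injective
  simp only [coboundary, ofMul_mul, ofMul_inv] at h ⊢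
  linear_combination (norm := abel) -h

/-- If `A` is free and `A ⧸ N` is generated by two elements, every cocycle on `A ⧸ N` lifts to a
coboundary. -/
theorem IsCocycle.liftsToCoboundary [Module.Free ℤ G] {N : AddSubgroup G}
    {Φ : G ⧸ N → G ⧸ N → G ⧸ N → Circle} (hΦ : IsCocycle Φ) {x y : G ⧸ N}
    (hxy : AddSubgroup.closure {x, y} = ⊤) : LiftsToCoboundary Φ := by
  obtain ⟨Ψ, hΨ, hn, hc⟩ := hΦ.exists_normalized
  refine hc.liftsToCoboundary ?_
  let L : (Fin 2 → ℤ) →ₗ[ℤ] G ⧸ N := Fintype.linearCombination ℤ ![x, y]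
  have hL : Function.Surjective L := by
    have hr : L.toAddMonoidHom.range = ⊤ := by
      rw [eq_top_iff, ← hxy, AddSubgroup.closure_le]
      rintro z (rfl | rfl)
      · exact ⟨Pi.single 0 1, by simp [L]⟩
      · exact ⟨Pi.single 1 1, by simp [L]⟩
    exact AddMonoidHom.range_eq_top.1 hr
  -- Freeness of `G` lifts the projection to `ℤ²`, and a primitive there is pulled back along `s`.
  obtain ⟨s, hs⟩ := Module.projective_lifting_property L
    (QuotientAddGroup.mk' N).toIntLinearMap hL
  have hs : ∀ a : G, L (s a) = (a : G ⧸ N) := fun a => LinearMap.congr_fun hs a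
  obtain ⟨g, hg⟩ := exists_eq_coboundary_of_rank_two
    (Φ := fun a b c => Ψ (L a) (L b) (L c))
    (fun a b c d => by simpa only [map_add] using hΨ (L a) (L b) (L c) (L d))
    ⟨fun a b => by rw [map_zero, hn.left], fun a b => by rw [map_zero, hn.mid],
      fun a b => by rw [map_zero, hn.right]⟩
  refine ⟨fun a b => g (s a) (s b), fun a b c => ?_⟩
  have := hg (s a) (s b) (s c)
  simp only [hs] at this
  rw [this]
  simp only [coboundary, map_add]

end CircleCochain

/-! ## The twists attached to central elements -/

namespace RootDatum

open CircleCochain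

variable {ι k M N : Type*} [Field k] [CharZero k] [AddCommGroup M] [Module k M]
  [AddCommGroup N] [Module k N] {R : RootPairing ι k M N} [R.IsCrystallographic] {b : R.Base}

theorem liftsToCoboundary_phiTau {τ : b.support → center R} (f : TwistFunction τ) :
    LiftsToCoboundary (phiTau f) :=
  ⟨fun x y => (f.toFun x y)⁻¹, fun x y z => by rw [coboundary_inv, phiTau_mk]⟩

/-- A cocycle on `P / Q` which lifts to the coboundary of a cochain that is trivial when the second
argument is in `Q` is one of the cocycles `Φ^τ`. -/
theorem exists_phiTau_eq {Φ : WeightModRoot R → WeightModRoot R → WeightModRoot R → Circle}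
    (hΦ : IsNormalized Φ) {g : weightLattice R → weightLattice R → Circle}
    (hg : ∀ x y z : weightLattice R, Φ x y z = coboundary g x y z)
    (hg1 : ∀ x, ∀ q ∈ rootLattice R, g x q = 1) :
    ∃ (τ : b.support → center R) (f : TwistFunction τ), Φ = phiTau f := by
  have hz : ∀ q ∈ rootLattice R, (q : WeightModRoot R) = 0 := fun q hq =>
    (QuotientAddGroup.eq_zero_iff q).2 hq
  -- An element of `Q` is put into the third, second and first place of `Φ = ∂g` in turn.
  have hright : ∀ x y q : weightLattice R, q ∈ rootLattice R → g x (y + q) = g x y := by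
    intro x y q hq
    have h := hg x y q
    rw [hz q hq, hΦ.right] at h
    simp only [coboundary, hg1 _ q hq] at h
    have h := congrArg Additive.ofMul h
    apply Additive.ofMul.injective
    simp only [ofMul_mul, ofMul_inv, ofMul_one] at h ⊢
    linear_combination (norm := abel) -h
  have hleft : ∀ x y q : weightLattice R, q ∈ rootLattice R → g (x + q) y = g q y * g x y := by
    intro x y q hq
    have h := hg x q y
    rw [hz q hq, hΦ.mid] at h
    simp only [coboundary, hg1 _ q hq, add_comm q y, hright _ _ _ hq] at h
    have h := congrArg Additive.ofMul h
    apply Additive.ofMul.injective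
    simp only [ofMul_mul, ofMul_inv, ofMul_one] at h ⊢
    linear_combination (norm := abel) h
  have hadd : ∀ q ∈ rootLattice R, ∀ x y : weightLattice R, g q (x + y) = g q x * g q y := by
    intro q hq x y
    have h := hg q x y
    rw [hz q hq, hΦ.left] at h
    simp only [coboundary, add_comm q x, hleft _ _ _ hq] at h
    have h := congrArg Additive.ofMul h
    apply Additive.ofMul.injective
    simp only [ofMul_mul, ofMul_inv, ofMul_one] at h ⊢
    linear_combination (norm := abel) -h
  have hroot : ∀ i, rootWeight R i ∈ rootLattice R := fun i =>
    AddSubgroup.subset_closure (Set.mem_range_self i)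
  let τ : b.support → center R := fun i =>
    ⟨{ toFun := fun y => (g (rootWeight R i) y)⁻¹
       map_zero_eq_one' := by rw [hg1 _ 0 (zero_mem _), inv_one]
       map_add_eq_mul' := fun x y => by rw [hadd _ (hroot i), mul_inv] },
      fun j => by
        change (g (rootWeight R i) (rootWeight R j))⁻¹ = 1
        rw [hg1 _ _ (hroot j), inv_one]⟩
  let f : TwistFunction τ :=
    { toFun := fun x y => (g x y)⁻¹
      add_root_right := fun x y q hq => by rw [hright x y q hq]
      add_simple_left := fun x y i => by
        rw [hleft _ _ _ (hroot i), mul_inv]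
        rfl }
  refine ⟨τ, f, funext fun x => funext fun y => funext fun z => ?_⟩
  induction x using QuotientAddGroup.induction_on with | _ x
  induction y using QuotientAddGroup.induction_on with | _ y
  induction z using QuotientAddGroup.induction_on with | _ z
  rw [phiTau_mk, hg]
  exact (inv_eq_iff_eq_inv.2 (coboundary_inv g x y z)).symm

theorem exists_cohomologous_phiTau_iff {M N : Type*} [AddCommGroup M] [Module ℂ M]
    [AddCommGroup N] [Module ℂ N] {R : RootPairing ι ℂ M N} [R.IsCrystallographic]
    [R.IsRootSystem] (b : R.Base)
    {Φ : WeightModRoot R → WeightModRoot R → WeightModRoot R → Circle} (hΦ : IsCocycle Φ) :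
    (∃ (τ : b.support → center R) (f : TwistFunction τ), Cohomologous Φ (phiTau f)) ↔
      LiftsToCoboundary Φ := by
  classical
  constructor
  · rintro ⟨τ, f, h⟩
    exact h.liftsToCoboundary (liftsToCoboundary_phiTau f)
  · intro h
    obtain ⟨Ψ, -, hn, hc⟩ := hΦ.exists_normalized
    -- Coordinates in the basis of simple roots are a priori complex; the real part is additive and
    -- keeps the values 0 and 1.
    let x : b.support → weightLattice R →+ ℝ := fun i =>
      { toFun := fun v => (b.toWeightBasis.repr (v : M) i).re
        map_zero' := by simp
        map_add' := fun v w => by simp }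
    have hx : ∀ i j : b.support, x i (rootWeight R j) = if i = j then 1 else 0 := by
      intro i j
      change (b.toWeightBasis.repr (R.root j) i).re = _
      rw [b.toWeightBasis_repr_root, Finsupp.single_apply]
      by_cases hij : i = j
      · simp [hij]
      · simp [hij, Ne.symm hij]
    obtain ⟨g, hg, hg1⟩ := exists_adapted_cochain (rootLattice R)
      (fun i : b.support => rootWeight R i) x (rootLattice_eq_closure b)
      (fun i => by rw [hx, if_pos rfl]) (fun i j hij => by rw [hx, if_neg hij]) hn
      (hc.symm.liftsToCoboundary h)
    obtain ⟨τ, f, rfl⟩ := exists_phiTau_eq (b := b) hn hg hg1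
    exact ⟨τ, f, hc⟩

end RootDatum

end

theorem mainTheorem2 {𝔤 : Type*} [LieRing 𝔤] [LieAlgebra ℂ 𝔤] [FiniteDimensional ℂ 𝔤]
    [LieAlgebra.IsSemisimple ℂ 𝔤] (𝔥 : LieSubalgebra ℂ 𝔤) [𝔥.IsCartanSubalgebra]
    (b : (LieAlgebra.IsKilling.rootSystem 𝔥).Base) :
    (∀ Φ : RootDatum.WeightModRoot (LieAlgebra.IsKilling.rootSystem 𝔥) →
          RootDatum.WeightModRoot (LieAlgebra.IsKilling.rootSystem 𝔥) →
          RootDatum.WeightModRoot (LieAlgebra.IsKilling.rootSystem 𝔥) → Circle,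
        CircleCochain.IsCocycle Φ →
        ((∃ (τ : b.support → RootDatum.center (LieAlgebra.IsKilling.rootSystem 𝔥))
            (f : RootDatum.TwistFunction τ),
            CircleCochain.Cohomologous Φ (RootDatum.phiTau f)) ↔
          CircleCochain.LiftsToCoboundary Φ)) ∧
    ((∃ x y : RootDatum.WeightModRoot (LieAlgebra.IsKilling.rootSystem 𝔥),
        AddSubgroup.closure {x, y} = ⊤) →
      ∀ Φ : RootDatum.WeightModRoot (LieAlgebra.IsKilling.rootSystem 𝔥) →
          RootDatum.WeightModRoot (LieAlgebra.IsKilling.rootSystem 𝔥) →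
          RootDatum.WeightModRoot (LieAlgebra.IsKilling.rootSystem 𝔥) → Circle,
        CircleCochain.IsCocycle Φ →
        (∃ (τ : b.support → RootDatum.center (LieAlgebra.IsKilling.rootSystem 𝔥))
            (f : RootDatum.TwistFunction τ),
            CircleCochain.Cohomologous Φ (RootDatum.phiTau f)) ∧
          CircleCochain.LiftsToCoboundary Φ) ∧
    (LieAlgebra.IsSimple ℂ 𝔤 →
      (∃ x y : RootDatum.WeightModRoot (LieAlgebra.IsKilling.rootSystem 𝔥),
        AddSubgroup.closure {x, y} = ⊤) ∧
      ∀ Φ : RootDatum.WeightModRoot (LieAlgebra.IsKilling.rootSystem 𝔥) →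
          RootDatum.WeightModRoot (LieAlgebra.IsKilling.rootSystem 𝔥) →
          RootDatum.WeightModRoot (LieAlgebra.IsKilling.rootSystem 𝔥) → Circle,
        CircleCochain.IsCocycle Φ →
        (∃ (τ : b.support → RootDatum.center (LieAlgebra.IsKilling.rootSystem 𝔥))
            (f : RootDatum.TwistFunction τ),
            CircleCochain.Cohomologous Φ (RootDatum.phiTau f)) ∧
          CircleCochain.LiftsToCoboundary Φ) := by
  have two : (∃ x y : RootDatum.WeightModRoot (LieAlgebra.IsKilling.rootSystem 𝔥),
        AddSubgroup.closure {x, y} = ⊤) →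
      ∀ Φ : RootDatum.WeightModRoot (LieAlgebra.IsKilling.rootSystem 𝔥) →
          RootDatum.WeightModRoot (LieAlgebra.IsKilling.rootSystem 𝔥) →
          RootDatum.WeightModRoot (LieAlgebra.IsKilling.rootSystem 𝔥) → Circle,
        CircleCochain.IsCocycle Φ →
        (∃ (τ : b.support → RootDatum.center (LieAlgebra.IsKilling.rootSystem 𝔥))
            (f : RootDatum.TwistFunction τ),
            CircleCochain.Cohomologous Φ (RootDatum.phiTau f)) ∧
          CircleCochain.LiftsToCoboundary Φ := by
    rintro ⟨x, y, hxy⟩ Φ hΦ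
    have := RootDatum.free_weightLattice b
    have h := hΦ.liftsToCoboundary hxy
    exact ⟨(RootDatum.exists_cohomologous_phiTau_iff b hΦ).2 h, h⟩
  refine ⟨fun Φ hΦ => RootDatum.exists_cohomologous_phiTau_iff b hΦ, two, fun _ => ?_⟩
  -- Simplicity of `𝔤` enters as irreducibility of the root system.
  have h := RootDatum.exists_two_generators_weightModRoot b
  exact ⟨h, two h⟩
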